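/- Throughout, Fourier transforms are $\widehat u(\xi)=\int_{\mathbb R}u(x)e^{-ix\xi}\,dx$, extended to $L^2(\mathbb R)$; $\mathcal H u(x)=\mathrm{p.v.}\,\frac1\pi\int_{\mathbb R}\frac{u(z)}{x-z}\,dz$ is the Hilbert transform; and $\partial_x^{-1}$ is defined by $\widehat{\partial_x^{-1}u}(\xi)=(i\xi)^{-1}\widehat u(\xi)$. Let $$\mathcal X=\{u\in H^{1/2}(\mathbb R;\mathbb R):\ \partial_x^{-1}u\in L^2(\mathbb R)\}.$$ Let $\beta,c,\gamma\in\mathbb R$, let $p>1$ be real, and let $f:\mathbb R\to\mathbb R$ be a $C^1$ function, homogeneous of degree $p$ in the sense that $s f'(s)=p f(s)$ for all $s\in\mathbb R$. A function $\varphi\in\mathcal X$ is called a solution of $$\beta\mathcal H\varphi_x-c\varphi+f(\varphi)=\gamma\,\partial_x^{-2}\varphi \qquad (2.1)$$ if it is a weak solution, i.e. for every real-valued Schwartz function $v$ with $v\in\mathcal X$, $$\beta\int_{\mathbb R}\varphi\,\mathcal H(v_x)\,dx-c\int_{\mathbb R}\varphi v\,dx+\int_{\mathbb R}f(\varphi)v\,dx=-\gamma\int_{\mathbb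 R}(\partial_x^{-1}\varphi)(\partial_x^{-1}v)\,dx .$$ **Theorem 3.1.** Equation (2.1) has no nonzero solution $\varphi\in\mathcal X$ if any one of the following conditions holds: (i) $\beta<0$, $\gamma>0$ and $c^3<\dfrac{27(3p+1)\gamma\beta^2}{(p-1)^3}$; (ii) $\beta>0$, $\gamma<0$ and $c^3>\dfrac{27(3p+1)\gamma\beta^2}{(p-1)^3}$; (iii) $f(u)=|u|^{p-1}u$, $\beta>0$ and $\gamma<0$; (iv) $f(u)=-|u|^{p-1}u$, $\beta<0$ and $\gamma>0$. -/

import Mathlib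

open MeasureTheory Filter Topology
open scoped SchwartzMap FourierTransform ENNReal

noncomputable section

namespace RGBO

/-- Real-valued square integrable functions on the line (modulo almost everywhere equality). -/
abbrev L2R : Type := Lp ℝ 2 (volume : Measure ℝ)

/-- A real `L²` function viewed as a complex-valued one. -/
def toComplex (u : L2R) : Lp ℂ 2 (volume : Measure ℝ) :=
  Complex.ofRealCLM.compLp u

/-- The Fourier side of `∂ₓ⁻¹ u`. Mathlib's Fourier transform is
`û(ξ) = ∫ u(x) e^{-2πi x ξ} dx`, so the symbol `(iζ)⁻¹` in the angular frequency `ζ = 2πξ`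
is `(2πiξ)⁻¹`. The value at the single point `ξ = 0` is irrelevant. -/
def invDerivFourier (u : L2R) (ξ : ℝ) : ℂ :=
  (2 * Real.pi * Complex.I * ξ)⁻¹ * (𝓕 (toComplex u) : Lp ℂ 2 (volume : Measure ℝ)) ξ

/-- The energy space `𝒳`: the real functions `u ∈ H^{1/2}(ℝ)` with `∂ₓ⁻¹ u ∈ L²(ℝ)`. -/
def energySpace : Set L2R :=
  {u | TemperedDistribution.MemSobolev (1 / 2) 2
        (Lp.toTemperedDistribution (toComplex u) : 𝓢'(ℝ, ℂ)) ∧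
      MemLp (invDerivFourier u) 2 volume}

/-- `∂ₓ⁻¹ u` for `u ∈ 𝒳`, the inverse Fourier transform of `(iζ)⁻¹ û`. Since `u` is real, this
inverse transform is real-valued; taking real parts only turns it into an element of `L²(ℝ; ℝ)`. -/
def invDeriv (u : L2R) (hu : u ∈ energySpace) : L2R :=
  Complex.reCLM.compLp (𝓕⁻ (hu.2.toLp (invDerivFourier u)) : Lp ℂ 2 (volume : Measure ℝ))

/-- The Hilbert transform `𝓗u(x) = p.v. (1/π) ∫ u(z) / (x - z) dz`. It is only applied to
Schwartz functions, for which the principal value exists at every point. -/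
def hilbertTransform (u : ℝ → ℝ) (x : ℝ) : ℝ :=
  limUnder (𝓝[>] (0 : ℝ)) fun ε : ℝ =>
    (1 / Real.pi) * ∫ z in {z : ℝ | ε < |x - z|}, u z / (x - z)

/-- `φ ∈ 𝒳` is a (weak) solution of the stationary equation
`β 𝓗φₓ - c φ + f(φ) = γ ∂ₓ⁻² φ`: the equation holds after pairing with every real Schwartz
function `v` that belongs to `𝒳`, where `⟨𝓗φₓ, v⟩ = ∫ φ 𝓗(vₓ)` and
`⟨∂ₓ⁻²φ, v⟩ = -∫ (∂ₓ⁻¹φ) (∂ₓ⁻¹v)`, since `𝓗`, `∂ₓ` and `∂ₓ⁻¹` are skew-adjoint. -/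
def IsSolution (β c γ : ℝ) (f : ℝ → ℝ) (φ : L2R) (hφ : φ ∈ energySpace) : Prop :=
  ∀ (v : 𝓢(ℝ, ℝ)) (hv : v.toLp 2 volume ∈ energySpace),
    β * (∫ x, φ x * hilbertTransform (deriv v) x) - c * (∫ x, φ x * v x) + (∫ x, f (φ x) * v x)
      = γ * (-∫ x, invDeriv φ hφ x * invDeriv (v.toLp 2 volume) hv x)

end RGBO

end

noncomputable section

namespace RGBO

/-! Write `a` for the Fourier transform of `φ` (frequency variable `ξ`, phase `2πxξ`), `β' = 2πβ`,
`γ' = γ/(2π)²`, and `N = ∫ φ f(φ)`, `A = ∫ |ξ||a|²`, `M = ∫ |a|²`, `Q = ∫ ξ⁻²|a|²`. Two identities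
decide everything. Pairing the equation with `φ` gives `N = -β'A + cM - γ'Q` (`energy_identity`).
Pairing it formally with `xφ'` gives `2N = (p+1)(cM - 3γ'Q)` (`pohozaev_identity`); `A` is absent
since `∫ xφ' 𝓗φ' = 0`.

Eliminating `N` leaves `∫ (-β'|ξ| + (3p+1)/2 · γ'ξ⁻² - (p-1)c/2)|a|² = 0`. When `β` and `γ` have
opposite signs, the first two terms of the weight have a common sign, and the bound on `c³` is
exactly what AM-GM needs to make the whole weight of one strict sign, so `a = 0`
(`eq_zero_of_cube_lt`). Eliminating `M` instead leaves `(p+1)β'A + (p-1)N - 2(p+1)γ'Q = 0`; for the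
sign-definite nonlinearities all three terms have one sign, so `Q = 0` (`eq_zero_of_mul_nonneg`).

The work lies in justifying the identities. The embedding `H^{1/2} ⊂ L^{2p}`
(`memLp_of_half_sobolev`) puts `f(φ)` in `L²`, so the weak equation becomes a pointwise relation
between Fourier transforms (`IsSolution.fourier_equation`). That relation forces `ξa` and `ξ⁻²a`
into `L²` (`memLp_mul_and_memLp_div_of_equation`); in particular `φ ∈ H¹`. Nothing is known about
`xφ'`, so the multiplier `x` is replaced by a multiple of `sin(2πεx)/ε`. On the Fourier side this is
a symmetric difference of translates, whose commutator with the symbol is computed exactly up to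
`O(ε²)` before division by `ε` (`abs_commutator_le`). The nonlinear term is integrated by parts
through bounded Schwartz approximations (`integral_sin_mul_comp_mul_deriv`). Letting `ε → 0` then
requires no spatial decay of `φ`. -/

/-! ### Fourier transform on `L²`: duality, inversion, modulation. -/

/-- Fourier duality between `L²` functions and Schwartz functions. -/
theorem integral_mul_fourier_eq (u : Lp ℂ 2 (volume : Measure ℝ)) (θ : 𝓢(ℝ, ℂ)) :
    ∫ ξ, θ ξ * (𝓕 u : Lp ℂ 2 (volume : Measure ℝ)) ξ = ∫ x, (𝓕 (θ : ℝ → ℂ)) x * u x := by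
  have h := congrArg (fun T : 𝓢'(ℝ, ℂ) => T θ) (Lp.fourier_toTemperedDistribution_eq u)
  simp only [TemperedDistribution.fourier_apply, Lp.toTemperedDistribution_apply,
    smul_eq_mul] at h
  rw [← h]
  rfl

/-- Duality for the inverse Fourier transform. -/
theorem integral_mul_fourierInv_eq (u : Lp ℂ 2 (volume : Measure ℝ)) (θ : 𝓢(ℝ, ℂ)) :
    ∫ ξ, θ ξ * (𝓕⁻ u : Lp ℂ 2 (volume : Measure ℝ)) ξ = ∫ x, (𝓕⁻ θ : 𝓢(ℝ, ℂ)) x * u x := by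
  have h := congrArg (fun T : 𝓢'(ℝ, ℂ) => T θ) (Lp.fourierInv_toTemperedDistribution_eq u)
  simp only [TemperedDistribution.fourierInv_apply, Lp.toTemperedDistribution_apply,
    smul_eq_mul] at h
  rw [← h]

/-- A locally integrable function annihilated by all compactly supported Schwartz functions
vanishes. -/
theorem ae_eq_of_integral_schwartz {G H : ℝ → ℂ} (hG : LocallyIntegrable G)
    (hH : LocallyIntegrable H)
    (h : ∀ θ : 𝓢(ℝ, ℂ), HasCompactSupport θ → ∫ x, θ x * G x = ∫ x, θ x * H x) :
    G =ᵐ[volume] H := by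
  refine ae_eq_of_integral_contDiff_smul_eq hG hH fun g hg hgc => ?_
  have hc : HasCompactSupport (fun x => (g x : ℂ)) := hgc.comp_left (g := Complex.ofReal) rfl
  have hs : ContDiff ℝ (⊤ : ℕ∞) (fun x => (g x : ℂ)) := Complex.ofRealCLM.contDiff.comp hg
  simp only [Complex.real_smul]
  exact h (hc.toSchwartzMap hs) hc

theorem locallyIntegrable_mul_coe_Lp {g : ℝ → ℂ} (hg : Continuous g)
    (u : Lp ℂ 2 (volume : Measure ℝ)) : LocallyIntegrable (fun x => g x * u x) :=
  ((Lp.memLp u).locallyIntegrable (by norm_num)).continuous_mul hg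

theorem integral_fourier_mul_eq_integral_mul_fourier {f g : ℝ → ℂ} (hf : Integrable f)
    (hg : Integrable g) : ∫ ξ, 𝓕 f ξ * g ξ = ∫ x, f x * 𝓕 g x := by
  have := VectorFourier.integral_fourierIntegral_smul_eq_flip (e := Real.fourierChar)
    (μ := (volume : Measure ℝ)) (ν := (volume : Measure ℝ)) (L := innerₗ ℝ)
    Real.continuous_fourierChar continuous_inner hf hg
  rw [flip_innerₗ] at this
  exact this

theorem norm_fourier_le_integral_norm (f : ℝ → ℂ) (x : ℝ) : ‖𝓕 f x‖ ≤ ∫ ξ, ‖f ξ‖ :=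
  VectorFourier.norm_fourierIntegral_le_integral_norm _ _ _ _ _

theorem norm_fourierInv_le_integral_norm (f : ℝ → ℂ) (x : ℝ) : ‖𝓕⁻ f x‖ ≤ ∫ ξ, ‖f ξ‖ := by
  rw [Real.fourierInv_eq_fourier_neg]
  exact norm_fourier_le_integral_norm f _

/-- The inverse Fourier transform on `L²` agrees with the integral on integrable functions. -/
theorem coe_fourierInv_ae_eq (h : Lp ℂ 2 (volume : Measure ℝ)) (hh : Integrable h) :
    (𝓕⁻ h : Lp ℂ 2 (volume : Measure ℝ)) =ᵐ[volume] 𝓕⁻ (h : ℝ → ℂ) := by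
  have hcont : Continuous (𝓕 fun x => h (-x)) :=
    VectorFourier.fourierIntegral_continuous Real.continuous_fourierChar
      continuous_inner hh.comp_neg
  rw [Real.fourierInv_eq_fourier_comp_neg]
  refine ae_eq_of_integral_schwartz ((Lp.memLp _).locallyIntegrable (by norm_num))
    hcont.locallyIntegrable fun θ _ => ?_
  rw [integral_mul_fourierInv_eq, ← integral_fourier_mul_eq_integral_mul_fourier θ.integrable
    hh.comp_neg, ← integral_neg_eq_self]
  refine integral_congr_ae (Eventually.of_forall fun x => ?_)
  beta_reduce
  rw [SchwartzMap.fourierInv_coe, Real.fourierInv_eq_fourier_neg, neg_neg]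

/-- Modulation on the physical side is translation on the Fourier side. -/
theorem fourier_modulation_ae_eq (ε : ℝ) (h k : Lp ℂ 2 (volume : Measure ℝ))
    (hk : k =ᵐ[volume] fun x => Complex.exp (2 * Real.pi * ε * x * Complex.I) * h x) :
    (𝓕 k : Lp ℂ 2 (volume : Measure ℝ)) =ᵐ[volume]
      fun ξ => (𝓕 h : Lp ℂ 2 (volume : Measure ℝ)) (ξ - ε) := by
  have hmp : MeasurePreserving (fun ξ : ℝ => ξ - ε) volume volume :=
    measurePreserving_sub_right volume ε
  refine ae_eq_of_integral_schwartz ((Lp.memLp _).locallyIntegrable (by norm_num))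
    (((Lp.memLp (𝓕 h)).comp_measurePreserving hmp).locallyIntegrable (by norm_num)) fun θ _ => ?_
  rw [integral_mul_fourier_eq]
  have e1 : ∫ x, θ x * (𝓕 h : Lp ℂ 2 (volume : Measure ℝ)) (x - ε) =
      ∫ x, (SchwartzMap.compSubConstCLM ℂ (-ε) θ) x * (𝓕 h : Lp ℂ 2 (volume : Measure ℝ)) x := by
    rw [← integral_add_right_eq_self _ ε]
    simp
  rw [e1, integral_mul_fourier_eq]
  refine integral_congr_ae ?_
  filter_upwards [hk] with x hx
  rw [hx, ← mul_assoc]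
  congr 1
  have := congrFun (VectorFourier.fourierIntegral_comp_add_right Real.fourierChar
    (volume : Measure ℝ) (innerₗ ℝ) θ ε) x
  have e2 : ((SchwartzMap.compSubConstCLM ℂ (-ε) θ : 𝓢(ℝ, ℂ)) : ℝ → ℂ) =
      (θ : ℝ → ℂ) ∘ fun v => v + ε := by
    ext v; simp
  rw [e2, Real.fourier_eq, Real.fourier_eq]
  simp only [VectorFourier.fourierIntegral, innerₗ_apply_apply] at this
  rw [this, Circle.smul_def, smul_eq_mul, mul_comm, Real.fourierChar_apply]
  congr 2
  simp
  ring

/-! ### The multiplier `|ξ|` as a singular integral of second differences. -/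

theorem integrableOn_and_integral_mul_exp_neg {y : ℝ} (hy : 0 < y) :
    IntegrableOn (fun t => t * Real.exp (-(y * t))) (Set.Ioi 0) ∧
      ∫ t in Set.Ioi (0 : ℝ), t * Real.exp (-(y * t)) = 1 / y ^ 2 := by
  constructor
  · have := integrableOn_rpow_mul_exp_neg_mul_rpow (p := 1) (s := 1) (b := y) (by norm_num)
      (by norm_num) hy
    simpa using this
  · have := Real.integral_rpow_mul_exp_neg_mul_Ioi (a := 2) (r := y) (by norm_num) hy
    norm_num at this
    simpa using this

/-- The real part of the elementary integral of `e^{-ty} - e^{(-t+i)y}`. Multiplied by `t`, the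
value becomes `1/(1+t²)`. -/
theorem integrableOn_and_integral_one_sub_cos_mul_exp {t : ℝ} (ht : 0 < t) :
    IntegrableOn (fun y => (1 - Real.cos y) * Real.exp (-(y * t))) (Set.Ioi 0) ∧
      ∫ y in Set.Ioi (0 : ℝ), (1 - Real.cos y) * Real.exp (-(y * t)) = 1 / t - t / (1 + t ^ 2) := by
  have h1 : ((-t : ℝ) : ℂ).re < 0 := by simpa using ht
  have h2 : (-(t : ℂ) + Complex.I).re < 0 := by simpa using ht
  have i1 := (integrableOn_exp_mul_complex_Ioi h1 0)
  have i2 := (integrableOn_exp_mul_complex_Ioi h2 0)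
  have v1 := integral_exp_mul_complex_Ioi h1 0
  have v2 := integral_exp_mul_complex_Ioi h2 0
  have hre : ∀ y : ℝ, RCLike.re (Complex.exp (((-t : ℝ) : ℂ) * y) -
      Complex.exp ((-(t : ℂ) + Complex.I) * y)) = (1 - Real.cos y) * Real.exp (-(y * t)) := by
    intro y
    have e : (-(t : ℂ) + Complex.I) * y = ((-(y * t) : ℝ) : ℂ) + (y : ℝ) * Complex.I := by
      push_cast; ring
    have e' : ((-t : ℝ) : ℂ) * y = ((-(y * t) : ℝ) : ℂ) := by push_cast; ring
    rw [e, e', Complex.exp_add, ← Complex.ofReal_exp]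
    simp only [RCLike.re_to_complex, Complex.sub_re, Complex.ofReal_re, Complex.re_ofReal_mul,
      Complex.exp_ofReal_mul_I_re]
    ring
  constructor
  · exact ((i1.sub i2).re).congr (Eventually.of_forall fun y => hre y)
  · have key := integral_re (f := fun y : ℝ => Complex.exp (((-t : ℝ) : ℂ) * y) -
      Complex.exp ((-(t : ℂ) + Complex.I) * y)) (i1.sub i2)
    rw [← integral_congr_ae (Eventually.of_forall fun y => hre y), key,
      integral_sub i1 i2, v1, v2]
    have hne : (-(t : ℂ) + Complex.I) ≠ 0 := fun h => by
      have := congrArg Complex.im h; simp at this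
    have hn : Complex.normSq (-(t : ℂ) + Complex.I) = 1 + t ^ 2 := by
      simp [Complex.normSq_apply]; ring
    simp only [Complex.ofReal_zero, mul_zero, Complex.exp_zero, RCLike.re_to_complex,
      Complex.sub_re, Complex.div_re, hn]
    simp

/-- `∫₀^∞ (1 - cos y) / y² dy = π / 2`. -/
theorem integrableOn_and_integral_one_sub_cos_div_sq :
    IntegrableOn (fun y : ℝ => (1 - Real.cos y) / y ^ 2) (Set.Ioi 0) ∧
      ∫ y in Set.Ioi (0 : ℝ), (1 - Real.cos y) / y ^ 2 = Real.pi / 2 := by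
  set μ := (volume : Measure ℝ).restrict (Set.Ioi 0)
  -- Since `1/y² = ∫₀^∞ t e^{-yt} dt`, Fubini for this nonnegative kernel reduces the claim to `∫₀^∞
  -- dt/(1+t²)`.
  let F : ℝ → ℝ → ℝ := fun t y => t * ((1 - Real.cos y) * Real.exp (-(y * t)))
  have hpos : ∀ᵐ t ∂μ, (0 : ℝ) < t := ae_restrict_mem measurableSet_Ioi
  have hinner : ∀ t : ℝ, 0 < t → ∫ y, F t y ∂μ = (1 + t ^ 2)⁻¹ := by
    intro t ht
    rw [integral_const_mul, (integrableOn_and_integral_one_sub_cos_mul_exp ht).2]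
    field_simp
    ring
  have hnn : ∀ t : ℝ, 0 < t → ∀ y, 0 ≤ F t y := fun t ht y =>
    mul_nonneg ht.le (mul_nonneg (by linarith [Real.cos_le_one y]) (Real.exp_pos _).le)
  have hint : Integrable (Function.uncurry F) (μ.prod μ) := by
    rw [integrable_prod_iff (by fun_prop)]
    constructor
    · filter_upwards [hpos] with t ht
      exact (integrableOn_and_integral_one_sub_cos_mul_exp ht).1.const_mul t
    · refine (integrable_inv_one_add_sq.integrableOn (s := Set.Ioi 0)).congr ?_
      filter_upwards [hpos] with t ht
      rw [← hinner t ht]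
      exact integral_congr_ae (Eventually.of_forall fun y => by
        simp [Function.uncurry, abs_of_nonneg (hnn t ht y)])
  have hval : ∀ y : ℝ, 0 < y → ∫ t, F t y ∂μ = (1 - Real.cos y) / y ^ 2 := by
    intro y hy
    have : ∀ t, F t y = (1 - Real.cos y) * (t * Real.exp (-(y * t))) := fun t => by
      simp only [F]; ring
    simp_rw [this]
    rw [integral_const_mul, (integrableOn_and_integral_mul_exp_neg hy).2]
    ring
  have hval' : (fun y => ∫ t, F t y ∂μ) =ᵐ[μ] fun y => (1 - Real.cos y) / y ^ 2 := by
    filter_upwards [hpos] with y hy using hval y hy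
  constructor
  · exact hint.integral_prod_right.congr hval'
  · rw [← integral_congr_ae hval', ← integral_integral_swap hint]
    have : (fun t => ∫ y, F t y ∂μ) =ᵐ[μ] fun t => (1 + t ^ 2)⁻¹ := by
      filter_upwards [hpos] with y hy using hinner y hy
    rw [integral_congr_ae this, integral_Ioi_inv_one_add_sq]
    simp

theorem integrableOn_and_integral_one_sub_cos_mul_div_sq (a : ℝ) :
    IntegrableOn (fun y : ℝ => (1 - Real.cos (a * y)) / y ^ 2) (Set.Ioi 0) ∧
      ∫ y in Set.Ioi (0 : ℝ), (1 - Real.cos (a * y)) / y ^ 2 = Real.pi / 2 * |a| := by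
  rcases eq_or_ne a 0 with rfl | ha
  · simp
  have hb : 0 < |a| := abs_pos.2 ha
  have h := integrableOn_and_integral_one_sub_cos_div_sq
  have e : (fun y : ℝ => (1 - Real.cos (a * y)) / y ^ 2) =
      fun y => |a| ^ 2 * ((1 - Real.cos (|a| * y)) / (|a| * y) ^ 2) := by
    ext y
    have : Real.cos (a * y) = Real.cos (|a| * y) := by
      rcases abs_choice a with h | h <;> rw [h]
      rw [neg_mul, Real.cos_neg]
    rw [this]
    field_simp
  rw [e]
  constructor
  · refine Integrable.const_mul ?_ _
    have := (integrableOn_Ioi_comp_mul_left_iff (fun y : ℝ => (1 - Real.cos y) / y ^ 2) 0 hb).2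
    rw [mul_zero] at this
    exact this h.1
  · rw [integral_const_mul, integral_comp_mul_left_Ioi (fun y : ℝ => (1 - Real.cos y) / y ^ 2) 0 hb,
      mul_zero, h.2, smul_eq_mul]
    field_simp

/-- A shift by `±y` multiplies the integrand by `e^{∓2πiξy}`, and `2 - e^{iη} - e^{-iη} = 2(1 - cos
η)`. -/
theorem fourier_second_difference {θ : ℝ → ℂ} (hθ : Integrable θ) (x y : ℝ) :
    2 * 𝓕 θ x - 𝓕 θ (x + y) - 𝓕 θ (x - y) =
      ∫ ξ, Complex.exp (((-2 * Real.pi * (ξ * x) : ℝ) : ℂ) * Complex.I) * θ ξ *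
        (2 * (1 - Real.cos (2 * Real.pi * ξ * y)) : ℝ) := by
  have hi : ∀ w : ℝ, Integrable
      (fun ξ : ℝ => Complex.exp (((-2 * Real.pi * (ξ * w) : ℝ) : ℂ) * Complex.I) * θ ξ) := by
    intro w
    refine hθ.bdd_mul (c := 1) (by fun_prop) (Eventually.of_forall fun ξ => ?_)
    rw [Complex.norm_exp_ofReal_mul_I]
  have hF : ∀ w, 𝓕 θ w =
      ∫ ξ, Complex.exp (((-2 * Real.pi * (ξ * w) : ℝ) : ℂ) * Complex.I) * θ ξ := by
    intro w
    rw [Real.fourier_eq']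
    refine integral_congr_ae (Eventually.of_forall fun ξ => ?_)
    simp [mul_comm w]
  have hs : Integrable (fun ξ : ℝ =>
      2 * (Complex.exp (((-2 * Real.pi * (ξ * x) : ℝ) : ℂ) * Complex.I) * θ ξ) -
      Complex.exp (((-2 * Real.pi * (ξ * (x + y)) : ℝ) : ℂ) * Complex.I) * θ ξ) :=
    ((hi x).const_mul 2).sub (hi (x + y))
  rw [hF, hF, hF, ← integral_const_mul, ← integral_sub ((hi x).const_mul 2) (hi (x + y)),
    ← integral_sub hs (hi (x - y))]
  refine integral_congr_ae (Eventually.of_forall fun ξ => ?_)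
  have e1 : ((-2 * Real.pi * (ξ * (x + y)) : ℝ) : ℂ) * Complex.I =
    ((-2 * Real.pi * (ξ * x) : ℝ) : ℂ) * Complex.I + -((2 * Real.pi * ξ * y : ℝ) : ℂ) * Complex.I := by
    push_cast; ring
  have e2 : ((-2 * Real.pi * (ξ * (x - y)) : ℝ) : ℂ) * Complex.I =
    ((-2 * Real.pi * (ξ * x) : ℝ) : ℂ) * Complex.I + ((2 * Real.pi * ξ * y : ℝ) : ℂ) * Complex.I := by
    push_cast; ring
  have e3 : Complex.exp (((2 * Real.pi * ξ * y : ℝ) : ℂ) * Complex.I) +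
      Complex.exp (-((2 * Real.pi * ξ * y : ℝ) : ℂ) * Complex.I) =
      2 * (Real.cos (2 * Real.pi * ξ * y) : ℝ) := by
    rw [Complex.ofReal_cos, Complex.two_cos]
  beta_reduce
  rw [e1, e2, Complex.exp_add, Complex.exp_add]
  push_cast at e3 ⊢
  linear_combination (-Complex.exp (-2 * Real.pi * (ξ * x) * Complex.I) * θ ξ) * e3

/-- The singular integral representing `π |D|` acting on the Fourier transform of `θ`. -/
theorem integrableOn_and_integral_second_difference {θ : ℝ → ℂ} (hθ : Integrable θ)
    (hθ' : Integrable fun ξ : ℝ => (ξ : ℂ) * θ ξ) (x : ℝ) :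
    IntegrableOn (fun y : ℝ => (2 * 𝓕 θ x - 𝓕 θ (x + y) - 𝓕 θ (x - y)) / (y : ℂ) ^ 2) (Set.Ioi 0) ∧
      ∫ y in Set.Ioi (0 : ℝ), (2 * 𝓕 θ x - 𝓕 θ (x + y) - 𝓕 θ (x - y)) / (y : ℂ) ^ 2 =
        Real.pi * 𝓕 (fun ξ : ℝ => ((2 * Real.pi * |ξ| : ℝ) : ℂ) * θ ξ) x := by
  set μ := (volume : Measure ℝ).restrict (Set.Ioi 0)
  let E : ℝ → ℂ := fun ξ => Complex.exp (((-2 * Real.pi * (ξ * x) : ℝ) : ℂ) * Complex.I)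
  -- The kernel is nonnegative with `y`-integral `π·2π|ξ|`, so integrability of `ξθ` is what Fubini
  -- needs.
  let k : ℝ → ℝ → ℝ := fun ξ y => 2 * ((1 - Real.cos (2 * Real.pi * ξ * y)) / y ^ 2)
  let F : ℝ → ℝ → ℂ := fun ξ y => E ξ * θ ξ * (k ξ y : ℝ)
  have hk0 : ∀ ξ y, 0 ≤ k ξ y := fun ξ y =>
    mul_nonneg (by norm_num) (div_nonneg (by linarith [Real.cos_le_one (2 * Real.pi * ξ * y)])
      (sq_nonneg y))
  have hki : ∀ ξ, Integrable (k ξ) μ := fun ξ =>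
    (integrableOn_and_integral_one_sub_cos_mul_div_sq (2 * Real.pi * ξ)).1.const_mul 2
  have hkv : ∀ ξ, ∫ y, k ξ y ∂μ = Real.pi * (2 * Real.pi * |ξ|) := fun ξ => by
    rw [integral_const_mul, (integrableOn_and_integral_one_sub_cos_mul_div_sq (2 * Real.pi * ξ)).2,
      abs_mul, abs_of_pos Real.two_pi_pos]
    ring
  have hE : ∀ ξ, ‖E ξ‖ = 1 := fun ξ => Complex.norm_exp_ofReal_mul_I _
  have hmeas : AEStronglyMeasurable (Function.uncurry F) (volume.prod μ) := by
    refine AEStronglyMeasurable.mul (AEStronglyMeasurable.mul ?_ hθ.1.comp_fst) ?_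
    · exact Continuous.aestronglyMeasurable (by fun_prop)
    · refine (Complex.measurable_ofReal.comp ?_).aestronglyMeasurable
      simp only [k]
      fun_prop
  have hint : Integrable (Function.uncurry F) (volume.prod μ) := by
    rw [integrable_prod_iff hmeas]
    constructor
    · exact Eventually.of_forall fun ξ => ((hki ξ).ofReal (𝕜 := ℂ)).const_mul (E ξ * θ ξ)
    · refine (hθ'.norm.const_mul (Real.pi * (2 * Real.pi))).congr (Eventually.of_forall fun ξ => ?_)
      have : ∀ y, ‖Function.uncurry F (ξ, y)‖ = ‖θ ξ‖ * k ξ y := fun y => by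
        simp [Function.uncurry, F, hE, abs_of_nonneg (hk0 ξ y)]
      simp_rw [this]
      rw [integral_const_mul, hkv]
      simp
      ring
  have hinner : ∀ y, ∫ ξ, F ξ y = (2 * 𝓕 θ x - 𝓕 θ (x + y) - 𝓕 θ (x - y)) / (y : ℂ) ^ 2 := by
    intro y
    rw [fourier_second_difference hθ, ← integral_div]
    refine integral_congr_ae (Eventually.of_forall fun ξ => ?_)
    simp only [F, E, k]
    push_cast
    ring
  constructor
  · refine hint.integral_prod_right.congr (Eventually.of_forall fun y => hinner y)
  · rw [← integral_congr_ae (Eventually.of_forall hinner), ← integral_integral_swap hint,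
      Real.fourier_eq', ← integral_const_mul]
    refine integral_congr_ae (Eventually.of_forall fun ξ => ?_)
    simp only [F]
    rw [integral_const_mul, integral_complex_ofReal, hkv]
    simp only [E]
    simp [mul_comm x]
    ring

/-! ### The Hilbert transform of a derivative. -/

/-- Substituting `y = x - z` and folding `y < -ε` onto `y > ε` exposes the cancellation in the odd
kernel. -/
theorem integral_principal_value_eq {w : ℝ → ℝ} (hw : Integrable w) (x : ℝ) {ε : ℝ} (hε : 0 < ε) :
    ∫ z in {z : ℝ | ε < |x - z|}, w z / (x - z) =
      ∫ y in Set.Ioi ε, (w (x - y) - w (x + y)) / y := by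
  have hm : MeasurableSet {z : ℝ | ε < |x - z|} :=
    measurableSet_lt measurable_const (by fun_prop)
  have hm' : MeasurableSet {y : ℝ | ε < |y|} :=
    measurableSet_lt measurable_const (by fun_prop)
  have e1 : ∫ z in {z : ℝ | ε < |x - z|}, w z / (x - z) =
      ∫ y in {y : ℝ | ε < |y|}, w (x - y) / y := by
    rw [← integral_indicator hm, ← integral_indicator hm', ← integral_sub_left_eq_self _ volume x]
    refine integral_congr_ae (Eventually.of_forall fun y => ?_)
    simp [Set.indicator]
  have hset : {y : ℝ | ε < |y|} = Set.Ioi ε ∪ Set.Iio (-ε) := by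
    ext y
    simp only [Set.mem_ofPred_eq, lt_abs, Set.mem_union, Set.mem_Ioi, Set.mem_Iio]
    constructor <;> rintro (h | h) <;> [left; right; left; right] <;> linarith
  have hi : ∀ {g : ℝ → ℝ}, Integrable g → IntegrableOn (fun y => g y / y) {y : ℝ | ε < |y|} := by
    intro g hg
    have : IntegrableOn (fun y => y⁻¹ * g y) {y : ℝ | ε < |y|} := by
      refine hg.integrableOn.bdd_mul (c := ε⁻¹) (measurable_inv.aestronglyMeasurable) ?_
      filter_upwards [ae_restrict_mem hm'] with y hy
      rw [norm_inv, Real.norm_eq_abs]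
      exact inv_anti₀ hε (le_of_lt hy)
    exact this.congr (Eventually.of_forall fun y => by simp [div_eq_inv_mul])
  have hsub : Integrable fun y => w (x - y) := hw.comp_sub_left x
  have hadd : Integrable fun y => w (x + y) := hw.comp_add_left x
  have hd : Disjoint (Set.Ioi ε) (Set.Iio (-ε)) := by
    rw [Set.disjoint_left]
    intro y h1 h2
    simp only [Set.mem_Ioi, Set.mem_Iio] at h1 h2
    linarith
  have i1 := (hi hsub)
  rw [hset] at i1
  have i2 := (hi hadd)
  rw [hset] at i2
  rw [e1, hset, setIntegral_union hd measurableSet_Iio (i1.mono_set Set.subset_union_left)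
    (i1.mono_set Set.subset_union_right)]
  have e2 : ∫ y in Set.Iio (-ε), w (x - y) / y = ∫ y in Set.Ioi ε, -(w (x + y) / y) := by
    rw [← integral_Iic_eq_integral_Iio, ← integral_comp_neg_Ioi]
    refine integral_congr_ae (Eventually.of_forall fun y => ?_)
    simp [div_neg]
  have i2' : IntegrableOn (fun y => -(w (x + y) / y)) (Set.Ioi ε) :=
    (i2.mono_set Set.subset_union_left).neg
  rw [e2, ← integral_add (i1.mono_set Set.subset_union_left) i2']
  refine integral_congr_ae (Eventually.of_forall fun y => ?_)
  simp only
  ring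

/-- The Hilbert transform of the derivative of a Schwartz function as an absolutely convergent
singular integral. -/
theorem hilbertTransform_deriv (v : 𝓢(ℝ, ℝ)) (x : ℝ)
    (hG : IntegrableOn (fun y : ℝ => (2 * v x - v (x + y) - v (x - y)) / y ^ 2) (Set.Ioi 0)) :
    hilbertTransform (deriv v) x =
      1 / Real.pi * ∫ y in Set.Ioi (0 : ℝ), (2 * v x - v (x + y) - v (x - y)) / y ^ 2 := by
  set G : ℝ → ℝ := fun y => 2 * v x - v (x + y) - v (x - y) with hGdef
  have hw : Integrable (deriv v) := (SchwartzMap.derivCLM ℝ ℝ v).integrable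
  have hGd : ∀ y, HasDerivAt G (deriv v (x - y) - deriv v (x + y)) y := by
    intro y
    have h1 : HasDerivAt (fun y => v (x + y)) (deriv v (x + y)) y := by
      simpa using (v.hasDerivAt (x + y)).comp_const_add x y
    have h2 : HasDerivAt (fun y => v (x - y)) (-deriv v (x - y)) y := by
      simpa using (v.hasDerivAt (x - y)).comp_const_sub x y
    exact (((hasDerivAt_const y (2 * v x)).sub h1).sub h2).congr_deriv (by ring)
  obtain ⟨C, hC⟩ : ∃ C, ∀ y, |G y| ≤ C := by
    set S := SchwartzMap.seminorm ℝ 0 0 v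
    have hS : ∀ y, |v y| ≤ S := fun y => v.norm_le_seminorm ℝ y
    refine ⟨4 * S, fun y => ?_⟩
    have a := abs_le.1 (hS x); have b := abs_le.1 (hS (x + y)); have c := abs_le.1 (hS (x - y))
    simp only [hGdef]
    rw [abs_le]
    constructor <;> linarith
  -- Integration by parts: the truncated integrand is `(G/y)' + G/y²`. Since `G` is bounded, only
  -- the boundary term at `ε` remains.
  have key : ∀ ε : ℝ, 0 < ε → ∫ z in {z : ℝ | ε < |x - z|}, deriv v z / (x - z) =
      -(G ε / ε) + ∫ y in Set.Ioi ε, G y / y ^ 2 := by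
    intro ε hε
    rw [integral_principal_value_eq hw x hε]
    have i2 : IntegrableOn (fun y => G y / y ^ 2) (Set.Ioi ε) :=
      hG.mono_set (Set.Ioi_subset_Ioi hε.le)
    have i1 : IntegrableOn (fun y => (deriv v (x - y) - deriv v (x + y)) / y) (Set.Ioi ε) := by
      have hg : Integrable fun y => deriv v (x - y) - deriv v (x + y) :=
        (hw.comp_sub_left x).sub (hw.comp_add_left x)
      have : IntegrableOn (fun y => y⁻¹ * (deriv v (x - y) - deriv v (x + y))) (Set.Ioi ε) := by
        refine hg.integrableOn.bdd_mul (c := ε⁻¹) (measurable_inv.aestronglyMeasurable) ?_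
        filter_upwards [ae_restrict_mem measurableSet_Ioi] with y hy
        rw [norm_inv, Real.norm_eq_abs]
        exact inv_anti₀ hε ((le_of_lt hy).trans (le_abs_self y))
      exact this.congr (Eventually.of_forall fun y => by simp [div_eq_inv_mul])
    have hd : ∀ y : ℝ, 0 < y → HasDerivAt (fun y => G y / y)
        ((deriv v (x - y) - deriv v (x + y)) / y - G y / y ^ 2) y := by
      intro y hy
      refine ((hGd y).div (hasDerivAt_id y) hy.ne').congr_deriv ?_
      simp only [id]
      field_simp
    have ht : Tendsto (fun y => G y / y) atTop (𝓝 0) := by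
      refine squeeze_zero_norm' (a := fun y => C / y) ?_ (tendsto_const_nhds.div_atTop tendsto_id)
      filter_upwards [eventually_gt_atTop 0] with y hy
      rw [norm_div, Real.norm_eq_abs, Real.norm_eq_abs, abs_of_pos hy]
      exact div_le_div_of_nonneg_right (hC y) hy.le
    have := integral_Ioi_of_hasDerivAt_of_tendsto (hd ε hε).continuousAt.continuousWithinAt
      (fun y hy => hd y (hε.trans hy)) (i1.sub i2) ht
    rw [integral_sub i1 i2] at this
    linarith
  refine Tendsto.limUnder_eq ?_
  -- The boundary term vanishes in the limit because `G(0) = 0` and `G'(0) = v'(x) - v'(x) = 0`.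
  have h0 : Tendsto (fun ε : ℝ => G ε / ε) (𝓝[>] 0) (𝓝 0) := by
    have := (hGd 0).tendsto_slope_zero_right
    simp only [zero_add, sub_zero, add_zero, sub_self, smul_eq_mul] at this
    have hG0 : G 0 = 0 := by simp only [hGdef, add_zero, sub_zero]; ring
    simpa [hG0, div_eq_inv_mul] using this
  have h1 : Tendsto (fun ε : ℝ => ∫ y in Set.Ioi ε, G y / y ^ 2) (𝓝[>] 0)
      (𝓝 (∫ y in Set.Ioi 0, G y / y ^ 2)) := by
    have hcov : AECover (volume.restrict (Set.Ioi (0 : ℝ))) (𝓝[>] (0 : ℝ)) fun i => Set.Ioi i :=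
      aecover_Ioi_of_Ioi (tendsto_id.mono_left nhdsWithin_le_nhds)
    refine (hcov.integral_tendsto_of_countably_generated hG).congr' ?_
    filter_upwards [self_mem_nhdsWithin] with ε hε
    rw [Measure.restrict_restrict measurableSet_Ioi,
      Set.inter_eq_left.2 (Set.Ioi_subset_Ioi (le_of_lt hε))]
  have h2 := ((h0.neg.add h1).const_mul (1 / Real.pi))
  rw [neg_zero, zero_add] at h2
  refine h2.congr' ?_
  filter_upwards [self_mem_nhdsWithin] with ε hε
  rw [key ε hε]

/-- For a real-linear functional `L`, applied to the Fourier transform of a Schwartz function,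
`𝓗 ∂ₓ` acts as the Fourier multiplier `|2πξ|`. -/
theorem hilbertTransform_deriv_fourier (L : ℂ →L[ℝ] ℝ) (θ : 𝓢(ℝ, ℂ)) (v : 𝓢(ℝ, ℝ))
    (hv : ∀ x, v x = L (𝓕 (θ : ℝ → ℂ) x)) (x : ℝ) :
    hilbertTransform (deriv v) x =
      L (𝓕 (fun ξ : ℝ => ((2 * Real.pi * |ξ| : ℝ) : ℂ) * θ ξ) x) := by
  have hθ' : Integrable fun ξ : ℝ => (ξ : ℂ) * θ ξ := by
    have := (SchwartzMap.smulLeftCLM ℂ (fun ξ : ℝ => (ξ : ℂ)) θ).integrable (μ := volume)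
    refine this.congr (Eventually.of_forall fun ξ => ?_)
    rw [SchwartzMap.smulLeftCLM_apply_apply (by fun_prop)]
    rfl
  obtain ⟨hi, hv'⟩ := integrableOn_and_integral_second_difference θ.integrable hθ' x
  have e : ∀ y : ℝ, (2 * v x - v (x + y) - v (x - y)) / y ^ 2 =
      L ((2 * 𝓕 (θ : ℝ → ℂ) x - 𝓕 (θ : ℝ → ℂ) (x + y) - 𝓕 (θ : ℝ → ℂ) (x - y)) / (y : ℂ) ^ 2) := by
    intro y
    have : (2 * 𝓕 (θ : ℝ → ℂ) x - 𝓕 (θ : ℝ → ℂ) (x + y) - 𝓕 (θ : ℝ → ℂ) (x - y)) / (y : ℂ) ^ 2 =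
        (y ^ 2)⁻¹ • ((2 : ℝ) • 𝓕 (θ : ℝ → ℂ) x - 𝓕 (θ : ℝ → ℂ) (x + y) -
          𝓕 (θ : ℝ → ℂ) (x - y)) := by
      simp only [Complex.real_smul]
      push_cast
      rw [div_eq_inv_mul]
    rw [this, L.map_smul, L.map_sub, L.map_sub, L.map_smul, hv, hv, hv, smul_eq_mul, smul_eq_mul,
      div_eq_inv_mul]
  have hiL := L.integrable_comp hi
  rw [hilbertTransform_deriv v x (hiL.congr (Eventually.of_forall fun y => (e y).symm)),
    integral_congr_ae (Eventually.of_forall e), L.integral_comp_comm hi, hv',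
    ← Complex.real_smul, map_smul, smul_eq_mul, ← mul_assoc, one_div,
    inv_mul_cancel₀ Real.pi_ne_zero, one_mul]

/-! ### Derivatives, `∂ₓ⁻¹` and the energy space on Schwartz functions. -/

open scoped LineDeriv in
theorem derivCLM_eq_lineDerivOp (f : 𝓢(ℝ, ℂ)) :
    SchwartzMap.derivCLM ℂ ℂ f = ∂_{(1 : ℝ)} f := by
  ext x
  rw [SchwartzMap.derivCLM_apply, SchwartzMap.lineDerivOp_apply_eq_fderiv]
  simp

theorem deriv_fourier_schwartz (θ : 𝓢(ℝ, ℂ)) (x : ℝ) :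
    deriv (𝓕 θ : 𝓢(ℝ, ℂ)) x =
      (𝓕 (SchwartzMap.smulLeftCLM ℂ (fun ξ : ℝ => -(2 * Real.pi * Complex.I * ξ)) θ) :
        𝓢(ℝ, ℂ)) x := by
  rw [← SchwartzMap.derivCLM_apply ℂ, derivCLM_eq_lineDerivOp, SchwartzMap.lineDerivOp_fourier_eq]
  congr 2
  ext ξ
  rw [SchwartzMap.smulLeftCLM_apply_apply (by fun_prop), smul_apply,
    SchwartzMap.smulLeftCLM_apply_apply (by fun_prop)]
  simp
  ring

theorem fourier_deriv_schwartz (θ : 𝓢(ℝ, ℂ)) (x : ℝ) :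
    (𝓕 (SchwartzMap.derivCLM ℂ ℂ θ) : 𝓢(ℝ, ℂ)) x =
      2 * Real.pi * Complex.I * x * (𝓕 θ : 𝓢(ℝ, ℂ)) x := by
  rw [derivCLM_eq_lineDerivOp, SchwartzMap.fourier_lineDerivOp_eq, smul_apply,
    SchwartzMap.smulLeftCLM_apply_apply (by fun_prop)]
  simp
  ring

theorem fourierInv_deriv_schwartz (θ : 𝓢(ℝ, ℂ)) (x : ℝ) :
    (𝓕⁻ (SchwartzMap.derivCLM ℂ ℂ θ) : 𝓢(ℝ, ℂ)) x =
      -(2 * Real.pi * Complex.I * x) * (𝓕⁻ θ : 𝓢(ℝ, ℂ)) x := by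
  rw [derivCLM_eq_lineDerivOp, SchwartzMap.fourierInv_lineDerivOp_eq, smul_apply,
    SchwartzMap.smulLeftCLM_apply_apply (by fun_prop)]
  simp
  ring

/-- A real Schwartz function viewed as a complex one. -/
def complexify : 𝓢(ℝ, ℝ) →L[ℝ] 𝓢(ℝ, ℂ) := SchwartzMap.postcompCLM Complex.ofRealCLM

@[simp]
theorem complexify_apply (d : 𝓢(ℝ, ℝ)) (x : ℝ) : complexify d x = (d x : ℂ) := rfl

theorem complexify_deriv (d : 𝓢(ℝ, ℝ)) :
    complexify (SchwartzMap.derivCLM ℝ ℝ d) = SchwartzMap.derivCLM ℂ ℂ (complexify d) := by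
  ext x
  rw [complexify_apply, SchwartzMap.derivCLM_apply, SchwartzMap.derivCLM_apply]
  exact ((d.hasDerivAt x).ofReal_comp.deriv).symm

theorem coe_toComplex (u : L2R) : toComplex u =ᵐ[volume] fun x => (u x : ℂ) :=
  ContinuousLinearMap.coeFn_compLp _ _

theorem toComplex_toLp (v : 𝓢(ℝ, ℝ)) : toComplex (v.toLp 2 volume) = (complexify v).toLp 2 := by
  refine Lp.ext ?_
  filter_upwards [coe_toComplex (v.toLp 2 volume), v.coeFn_toLp 2 volume,
    (complexify v).coeFn_toLp 2 volume] with x h1 h2 h3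
  rw [h1, h2, h3, complexify_apply]

theorem invDerivFourier_deriv (e : 𝓢(ℝ, ℝ)) :
    invDerivFourier ((SchwartzMap.derivCLM ℝ ℝ e).toLp 2 volume) =ᵐ[volume]
      (𝓕 (complexify e) : 𝓢(ℝ, ℂ)) := by
  have h0 : ∀ᵐ ξ : ℝ, ξ ≠ 0 := by
    simp [ae_iff]
  unfold invDerivFourier
  rw [toComplex_toLp, SchwartzMap.toLp_fourier_eq, complexify_deriv]
  filter_upwards [h0, (𝓕 (SchwartzMap.derivCLM ℂ ℂ (complexify e)) : 𝓢(ℝ, ℂ)).coeFn_toLp 2 volume]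
    with ξ hξ h
  rw [h, fourier_deriv_schwartz, inv_mul_cancel_left₀]
  simp [hξ, Real.pi_ne_zero, Complex.I_ne_zero]

/-- The factor `ξ` produced by the derivative cancels the singular symbol at the origin, so
derivatives of Schwartz functions are admissible test functions. -/
theorem deriv_toLp_mem_energySpace (e : 𝓢(ℝ, ℝ)) :
    (SchwartzMap.derivCLM ℝ ℝ e).toLp 2 volume ∈ energySpace := by
  refine ⟨?_, (memLp_congr_ae (invDerivFourier_deriv e)).2
    ((𝓕 (complexify e) : 𝓢(ℝ, ℂ)).memLp 2 volume)⟩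
  rw [toComplex_toLp, Lp.toTemperedDistribution_toLp_eq]
  exact SchwartzMap.memSobolev _

theorem invDeriv_deriv (e : 𝓢(ℝ, ℝ)) (h : (SchwartzMap.derivCLM ℝ ℝ e).toLp 2 volume ∈ energySpace) :
    invDeriv ((SchwartzMap.derivCLM ℝ ℝ e).toLp 2 volume) h =ᵐ[volume] e := by
  have h1 : h.2.toLp (invDerivFourier ((SchwartzMap.derivCLM ℝ ℝ e).toLp 2 volume)) =
      (𝓕 (complexify e) : 𝓢(ℝ, ℂ)).toLp 2 := by
    refine Lp.ext ?_
    filter_upwards [h.2.coeFn_toLp, invDerivFourier_deriv e,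
      (𝓕 (complexify e) : 𝓢(ℝ, ℂ)).coeFn_toLp 2 volume] with x h1 h2 h3
    rw [h1, h2, h3]
  unfold invDeriv
  rw [h1, SchwartzMap.toLp_fourierInv_eq, FourierTransform.fourierInv_fourier_eq]
  filter_upwards [ContinuousLinearMap.coeFn_compLp Complex.reCLM ((complexify e).toLp 2 volume),
    (complexify e).coeFn_toLp 2 volume] with x h1 h2
  rw [h1, h2]
  simp

theorem integrable_schwartz_mul_coe_Lp {𝕜 : Type*} [RCLike 𝕜] (θ : 𝓢(ℝ, 𝕜))
    (u : Lp 𝕜 2 (volume : Measure ℝ)) : Integrable fun x => θ x * u x :=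
  (θ.memLp 2 volume).integrable_mul (Lp.memLp u)

/-- On the Fourier side `(2πiξ)⁻¹` meets the factor `-2πiξ` from the derivative. With test functions
that are second derivatives, this removes `∂ₓ⁻¹` from the weak equation altogether. -/
theorem integral_invDeriv_mul_deriv (φ : L2R) (hφ : φ ∈ energySpace) (d : 𝓢(ℝ, ℝ)) :
    ∫ x, invDeriv φ hφ x * SchwartzMap.derivCLM ℝ ℝ d x = -∫ x, φ x * d x := by
  set a : Lp ℂ 2 (volume : Measure ℝ) := 𝓕⁻ (hφ.2.toLp (invDerivFourier φ))
  have e1 : ∫ x, invDeriv φ hφ x * SchwartzMap.derivCLM ℝ ℝ d x =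
      (∫ x, SchwartzMap.derivCLM ℂ ℂ (complexify d) x * a x).re := by
    have := integral_re (integrable_schwartz_mul_coe_Lp (SchwartzMap.derivCLM ℂ ℂ (complexify d)) a)
    rw [← RCLike.re_to_complex, ← this]
    refine integral_congr_ae ?_
    filter_upwards [ContinuousLinearMap.coeFn_compLp Complex.reCLM a] with x hx
    unfold invDeriv
    rw [hx, ← complexify_deriv, complexify_apply, RCLike.re_to_complex, Complex.re_ofReal_mul,
      mul_comm]
    rfl
  have e2 : ∫ x, φ x * d x = (∫ x, complexify d x * toComplex φ x).re := by
    have := integral_re (integrable_schwartz_mul_coe_Lp (complexify d) (toComplex φ))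
    rw [← RCLike.re_to_complex, ← this]
    refine integral_congr_ae ?_
    filter_upwards [coe_toComplex φ] with x hx
    rw [hx, complexify_apply, RCLike.re_to_complex, Complex.re_ofReal_mul, mul_comm]
    simp
  have h0 : ∀ᵐ ξ : ℝ, ξ ≠ 0 := by
    simp [ae_iff]
  have e3 := integral_mul_fourierInv_eq (𝓕 (toComplex φ)) (complexify d)
  rw [FourierTransform.fourierInv_fourier_eq] at e3
  rw [e1, e2, ← Complex.neg_re, integral_mul_fourierInv_eq, e3, ← integral_neg]
  congr 1
  refine integral_congr_ae ?_
  filter_upwards [hφ.2.coeFn_toLp, h0] with ξ h hξ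
  rw [h, fourierInv_deriv_schwartz]
  unfold invDerivFourier
  have : (2 * Real.pi * Complex.I * ξ : ℂ) ≠ 0 := by
    simp [hξ, Real.pi_ne_zero, Complex.I_ne_zero]
  rw [neg_mul, neg_mul, mul_right_comm, ← mul_assoc, mul_inv_cancel₀ this, one_mul, mul_comm]

/-! ### From the weak equation to a pointwise equation in frequency. -/

/-- The functional need only be real-linear because `u` is real. This allows the real test functions
`Re 𝓕θ` and `Im 𝓕θ`. -/
theorem integral_mul_functional (L : ℂ →L[ℝ] ℝ) (θ : 𝓢(ℝ, ℂ)) (u : L2R) :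
    ∫ x, u x * L ((𝓕 (θ : ℝ → ℂ)) x) =
      L (∫ ξ, θ ξ * (𝓕 (toComplex u) : Lp ℂ 2 (volume : Measure ℝ)) ξ) := by
  rw [integral_mul_fourier_eq, ← L.integral_comp_comm]
  · refine integral_congr_ae ?_
    filter_upwards [coe_toComplex u] with x hx
    have : 𝓕 (θ : ℝ → ℂ) x * (u x : ℂ) = u x • 𝓕 (θ : ℝ → ℂ) x := by
      rw [Complex.real_smul, mul_comm]
    rw [hx, this, L.map_smul, smul_eq_mul]
  · exact integrable_schwartz_mul_coe_Lp (𝓕 θ) (toComplex u)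

/-- The weak equation, tested against `d''` with `d` a real-linear functional of `𝓕 θ`. -/
theorem IsSolution.functional_eq {β c γ : ℝ} {f : ℝ → ℝ} {φ : L2R} {hφ : φ ∈ energySpace}
    (hsol : IsSolution β c γ f φ hφ) {g : L2R} (hg : g =ᵐ[volume] fun x => f (φ x))
    (L : ℂ →L[ℝ] ℝ) (θ θ₂ θ₃ : 𝓢(ℝ, ℂ)) (h₂ : ∀ ξ, θ₂ ξ = -((2 * Real.pi * ξ : ℝ) : ℂ) ^ 2 * θ ξ)
    (h₃ : ∀ ξ, θ₃ ξ = ((2 * Real.pi * |ξ| : ℝ) : ℂ) * θ₂ ξ) :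
    β * L (∫ ξ, θ₃ ξ * (𝓕 (toComplex φ) : Lp ℂ 2 (volume : Measure ℝ)) ξ)
      - c * L (∫ ξ, θ₂ ξ * (𝓕 (toComplex φ) : Lp ℂ 2 (volume : Measure ℝ)) ξ)
      + L (∫ ξ, θ₂ ξ * (𝓕 (toComplex g) : Lp ℂ 2 (volume : Measure ℝ)) ξ) =
      γ * L (∫ ξ, θ ξ * (𝓕 (toComplex φ) : Lp ℂ 2 (volume : Measure ℝ)) ξ) := by
  set D : 𝓢(ℝ, ℝ) → 𝓢(ℝ, ℝ) := fun u => SchwartzMap.derivCLM ℝ ℝ u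
  set P : 𝓢(ℝ, ℂ) → 𝓢(ℝ, ℝ) := fun u => SchwartzMap.postcompCLM L u
  set M : 𝓢(ℝ, ℂ) → 𝓢(ℝ, ℂ) :=
    fun u => SchwartzMap.smulLeftCLM ℂ (fun ξ : ℝ => -(2 * Real.pi * Complex.I * ξ)) u
  have hDP : ∀ u : 𝓢(ℝ, ℂ), D (P (𝓕 u)) = P (𝓕 (M u)) := by
    intro u
    ext x
    simp only [D, P, M]
    rw [SchwartzMap.derivCLM_apply, SchwartzMap.postcompCLM_apply, ← deriv_fourier_schwartz]
    exact (L.hasFDerivAt.comp_hasDerivAt x ((𝓕 u : 𝓢(ℝ, ℂ)).hasDerivAt x)).deriv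
  -- Two derivatives in `x` multiply `θ` by `(2πiξ)² = -(2πξ)²`.
  have hM : M (M θ) = θ₂ := by
    ext ξ
    simp only [M]
    rw [SchwartzMap.smulLeftCLM_apply_apply (by fun_prop),
      SchwartzMap.smulLeftCLM_apply_apply (by fun_prop), h₂]
    simp only [smul_eq_mul]
    push_cast
    ring_nf
    rw [Complex.I_sq]
    ring
  have hv : D (D (P (𝓕 θ))) = P (𝓕 θ₂) := by rw [hDP, hDP, hM]
  have hmem := deriv_toLp_mem_energySpace (D (P (𝓕 θ)))
  have h := hsol (D (D (P (𝓕 θ)))) hmem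
  have hx : ∀ x, D (D (P (𝓕 θ))) x = L (𝓕 (θ₂ : ℝ → ℂ) x) := fun x => by rw [hv]; rfl
  have hH : ∀ x, hilbertTransform (deriv (D (D (P (𝓕 θ))))) x = L (𝓕 (θ₃ : ℝ → ℂ) x) := by
    intro x
    have : (fun ξ : ℝ => ((2 * Real.pi * |ξ| : ℝ) : ℂ) * θ₂ ξ) = θ₃ := funext fun ξ => (h₃ ξ).symm
    rw [hilbertTransform_deriv_fourier L θ₂ _ hx x, this]
  have e1 : ∫ x, f (φ x) * D (D (P (𝓕 θ))) x = ∫ x, g x * L (𝓕 (θ₂ : ℝ → ℂ) x) := by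
    refine integral_congr_ae ?_
    filter_upwards [hg] with x hgx
    rw [hgx, hx]
  have e2 : -∫ x, invDeriv φ hφ x * invDeriv ((D (D (P (𝓕 θ)))).toLp 2 volume) hmem x =
      ∫ x, φ x * L (𝓕 (θ : ℝ → ℂ) x) := by
    rw [neg_eq_iff_eq_neg]
    refine Eq.trans ?_ (integral_invDeriv_mul_deriv φ hφ (P (𝓕 θ)))
    refine integral_congr_ae ?_
    filter_upwards [invDeriv_deriv _ hmem] with x hx
    rw [hx]
  rw [e1, e2] at h
  simp_rw [hH, hx] at h
  simpa only [integral_mul_functional] using h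

/-- The real and imaginary parts of the identity come from the two functionals `Re` and `Im`;
together they give one complex equation for every real cut-off `χ`. -/
theorem IsSolution.integral_eq_zero {β c γ : ℝ} {f : ℝ → ℝ} {φ : L2R} {hφ : φ ∈ energySpace}
    (hsol : IsSolution β c γ f φ hφ) {g : L2R} (hg : g =ᵐ[volume] fun x => f (φ x))
    (χ : ℝ → ℝ) (θ θ₂ θ₃ : 𝓢(ℝ, ℂ)) (h₁ : ∀ ξ, θ ξ = χ ξ)
    (h₂ : ∀ ξ, θ₂ ξ = -((2 * Real.pi * ξ : ℝ) : ℂ) ^ 2 * χ ξ)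
    (h₃ : ∀ ξ, θ₃ ξ = ((2 * Real.pi * |ξ| : ℝ) : ℂ) * (-((2 * Real.pi * ξ : ℝ) : ℂ) ^ 2 * χ ξ)) :
    ∫ ξ, χ ξ • ((((2 * Real.pi * ξ) ^ 2 * (c - 2 * Real.pi * β * |ξ|) - γ : ℝ) : ℂ) *
        (𝓕 (toComplex φ) : Lp ℂ 2 (volume : Measure ℝ)) ξ -
      (((2 * Real.pi * ξ) ^ 2 : ℝ) : ℂ) * (𝓕 (toComplex g) : Lp ℂ 2 (volume : Measure ℝ)) ξ) = 0 := by
  set a := (𝓕 (toComplex φ) : Lp ℂ 2 (volume : Measure ℝ))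
  set b := (𝓕 (toComplex g) : Lp ℂ 2 (volume : Measure ℝ))
  have i1 := integrable_schwartz_mul_coe_Lp θ₃ a
  have i2 := integrable_schwartz_mul_coe_Lp θ₂ a
  have i3 := integrable_schwartz_mul_coe_Lp θ₂ b
  have i4 := integrable_schwartz_mul_coe_Lp θ a
  have hL := fun L : ℂ →L[ℝ] ℝ => hsol.functional_eq hg L θ θ₂ θ₃ 
    (fun ξ => by rw [h₂, h₁]) (fun ξ => by rw [h₃, h₂])
  have hz : (β : ℂ) * (∫ ξ, θ₃ ξ * a ξ) - c * (∫ ξ, θ₂ ξ * a ξ) + (∫ ξ, θ₂ ξ * b ξ) -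
      γ * (∫ ξ, θ ξ * a ξ) = 0 := by
    have hre := hL Complex.reCLM
    have him := hL Complex.imCLM
    simp only [Complex.reCLM_apply, Complex.imCLM_apply] at hre him
    apply Complex.ext
    · simp only [Complex.sub_re, Complex.add_re, Complex.re_ofReal_mul, Complex.zero_re]
      linarith
    · simp only [Complex.sub_im, Complex.add_im, Complex.im_ofReal_mul, Complex.zero_im]
      linarith
  have j1 : Integrable fun ξ => (β : ℂ) * (θ₃ ξ * a ξ) := i1.const_mul _
  have j2 : Integrable fun ξ => (c : ℂ) * (θ₂ ξ * a ξ) := i2.const_mul _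
  have j4 : Integrable fun ξ => (γ : ℂ) * (θ ξ * a ξ) := i4.const_mul _
  have j12 : Integrable fun ξ => (β : ℂ) * (θ₃ ξ * a ξ) - c * (θ₂ ξ * a ξ) := j1.sub j2
  have j123 : Integrable fun ξ => (β : ℂ) * (θ₃ ξ * a ξ) - c * (θ₂ ξ * a ξ) + θ₂ ξ * b ξ :=
    j12.add i3
  rw [← integral_const_mul, ← integral_const_mul, ← integral_const_mul, ← integral_sub j1 j2,
    ← integral_add j12 i3, ← integral_sub j123 j4] at hz
  rw [← hz]
  refine integral_congr_ae (Eventually.of_forall fun ξ => ?_)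
  simp only [h₁, h₂, h₃, Complex.real_smul]
  push_cast
  ring

/-- The Fourier transform of a solution satisfies the equation pointwise almost everywhere. -/
theorem IsSolution.fourier_equation {β c γ : ℝ} {f : ℝ → ℝ} {φ : L2R} {hφ : φ ∈ energySpace}
    (hsol : IsSolution β c γ f φ hφ) {g : L2R} (hg : g =ᵐ[volume] fun x => f (φ x)) :
    ∀ᵐ ξ : ℝ, (((2 * Real.pi * ξ) ^ 2 * (c - 2 * Real.pi * β * |ξ|) - γ : ℝ) : ℂ) *
        (𝓕 (toComplex φ) : Lp ℂ 2 (volume : Measure ℝ)) ξ -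
      (((2 * Real.pi * ξ) ^ 2 : ℝ) : ℂ) * (𝓕 (toComplex g) : Lp ℂ 2 (volume : Measure ℝ)) ξ = 0 := by
  set a := (𝓕 (toComplex φ) : Lp ℂ 2 (volume : Measure ℝ))
  set b := (𝓕 (toComplex g) : Lp ℂ 2 (volume : Measure ℝ))
  have h0 : ∀ᵐ ξ : ℝ, ξ ≠ 0 := by
    simp [ae_iff]
  -- The symbol `|ξ|` is not smooth at the origin, so `θ₃` is Schwartz only for cut-offs supported
  -- away from it. Removing one null point costs nothing.
  have hopen : IsOpen ({0}ᶜ : Set ℝ) := isOpen_compl_singleton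
  have hloc : LocallyIntegrable (fun ξ : ℝ =>
      (((2 * Real.pi * ξ) ^ 2 * (c - 2 * Real.pi * β * |ξ|) - γ : ℝ) : ℂ) * a ξ -
      (((2 * Real.pi * ξ) ^ 2 : ℝ) : ℂ) * b ξ) :=
    (locallyIntegrable_mul_coe_Lp (by fun_prop) a).sub
      (locallyIntegrable_mul_coe_Lp (by fun_prop) b)
  have key := hopen.ae_eq_zero_of_integral_contDiff_smul_eq_zero (μ := volume)
    (hloc.locallyIntegrableOn _) ?_
  · filter_upwards [h0, key] with ξ h1 h2 using h2 h1
  intro χ hχ hχc hχ0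
  have hcs : HasCompactSupport fun ξ => (χ ξ : ℂ) := hχc.comp_left (g := Complex.ofReal) rfl
  have hsm : ContDiff ℝ (⊤ : ℕ∞) fun ξ => (χ ξ : ℂ) := Complex.ofRealCLM.contDiff.comp hχ
  have hsm2 : ContDiff ℝ (⊤ : ℕ∞) fun ξ : ℝ => -((2 * Real.pi * ξ : ℝ) : ℂ) ^ 2 * (χ ξ : ℂ) :=
    ContDiff.mul (by
      have : ContDiff ℝ (⊤ : ℕ∞) fun ξ : ℝ => ((2 * Real.pi * ξ : ℝ) : ℂ) :=
        Complex.ofRealCLM.contDiff.comp (contDiff_const.mul contDiff_id)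
      exact (this.pow 2).neg) hsm
  have hcs2 : HasCompactSupport fun ξ : ℝ => -((2 * Real.pi * ξ : ℝ) : ℂ) ^ 2 * (χ ξ : ℂ) :=
    hcs.mul_left
  have hcs3 : HasCompactSupport fun ξ : ℝ => ((2 * Real.pi * |ξ| : ℝ) : ℂ) *
      (-((2 * Real.pi * ξ : ℝ) : ℂ) ^ 2 * (χ ξ : ℂ)) := hcs2.mul_left
  have hsm3 : ContDiff ℝ (⊤ : ℕ∞) fun ξ : ℝ => ((2 * Real.pi * |ξ| : ℝ) : ℂ) *
      (-((2 * Real.pi * ξ : ℝ) : ℂ) ^ 2 * (χ ξ : ℂ)) := by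
    rw [contDiff_iff_contDiffAt]
    intro ξ
    rcases eq_or_ne ξ 0 with rfl | hξ
    · have : (0 : ℝ) ∉ tsupport χ := fun h => hχ0 h rfl
      have hz := notMem_tsupport_iff_eventuallyEq.1 this
      refine contDiffAt_const (c := (0 : ℂ)) |>.congr_of_eventuallyEq ?_
      filter_upwards [hz] with x hx
      simp [hx]
    · refine ContDiffAt.mul ?_ hsm2.contDiffAt
      exact Complex.ofRealCLM.contDiff.contDiffAt.comp ξ
        (contDiffAt_const.mul (contDiffAt_abs hξ))
  obtain ⟨θ, h₁⟩ : ∃ θ : 𝓢(ℝ, ℂ), ∀ ξ, θ ξ = χ ξ := ⟨hcs.toSchwartzMap hsm, fun _ => rfl⟩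
  obtain ⟨θ₂, h₂⟩ : ∃ θ : 𝓢(ℝ, ℂ), ∀ ξ, θ ξ = -((2 * Real.pi * ξ : ℝ) : ℂ) ^ 2 * χ ξ :=
    ⟨HasCompactSupport.toSchwartzMap hcs2 hsm2, fun _ => rfl⟩
  obtain ⟨θ₃, h₃⟩ : ∃ θ : 𝓢(ℝ, ℂ), ∀ ξ, θ ξ =
      ((2 * Real.pi * |ξ| : ℝ) : ℂ) * (-((2 * Real.pi * ξ : ℝ) : ℂ) ^ 2 * χ ξ) :=
    ⟨HasCompactSupport.toSchwartzMap hcs3 hsm3, fun _ => rfl⟩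
  exact hsol.integral_eq_zero hg χ θ θ₂ θ₃ h₁ h₂ h₃

/-! ### The Sobolev embedding of `H^{1/2}` by dyadic decomposition. -/

/-- Passes from the Bessel weight `(1+ξ²)^{1/4}` to the comparable `(1+|ξ|)^{1/2}`, which fits the
dyadic shells. The constant 2 is generous: `(1+|ξ|)² ≤ 16(1+ξ²)`. -/
theorem MemSobolev_half_memLp {u : Lp ℂ 2 (volume : Measure ℝ)}
    (hu : TemperedDistribution.MemSobolev (1 / 2) 2 (Lp.toTemperedDistribution u : 𝓢'(ℝ, ℂ))) :
    MemLp (fun ξ : ℝ => (Real.sqrt (1 + |ξ|) : ℂ) * (𝓕 u : Lp ℂ 2 (volume : Measure ℝ)) ξ) 2 := by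
  obtain ⟨g, hg⟩ := TemperedDistribution.memSobolev_iff_exists_smulLeftCLM_fourier.1 hu
  rw [Lp.fourier_toTemperedDistribution_eq] at hg
  set a : Lp ℂ 2 (volume : Measure ℝ) := 𝓕 u
  have hgrowth : (fun x : ℝ => (((1 + ‖x‖ ^ 2) ^ ((1 / 2 : ℝ) / 2) : ℝ) : ℂ)).HasTemperateGrowth := by
    fun_prop
  have hae : (fun x : ℝ => (((1 + ‖x‖ ^ 2) ^ ((1 / 2 : ℝ) / 2) : ℝ) : ℂ) * a x) =ᵐ[volume] g := by
    refine ae_eq_of_integral_schwartz (locallyIntegrable_mul_coe_Lp hgrowth.1.continuous a)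
      ((Lp.memLp g).locallyIntegrable (by norm_num)) fun θ _ => ?_
    have h := congrArg (fun T : 𝓢'(ℝ, ℂ) => T θ) hg
    simp only [TemperedDistribution.smulLeftCLM_apply_apply, Lp.toTemperedDistribution_apply,
      smul_eq_mul] at h
    rw [← h]
    refine integral_congr_ae (Eventually.of_forall fun x => ?_)
    beta_reduce
    rw [SchwartzMap.smulLeftCLM_apply_apply hgrowth, smul_eq_mul]
    ring
  refine (Lp.memLp g).of_le_mul (c := 2) ?_ ?_
  · refine AEStronglyMeasurable.mul ?_ (Lp.aestronglyMeasurable a)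
    exact Continuous.aestronglyMeasurable (by fun_prop)
  · filter_upwards [hae] with x hx
    rw [← hx, norm_mul, norm_mul, ← mul_assoc]
    refine mul_le_mul_of_nonneg_right ?_ (norm_nonneg _)
    rw [Complex.norm_real, Complex.norm_real, Real.norm_of_nonneg (Real.sqrt_nonneg _),
      Real.norm_of_nonneg (by positivity)]
    set y := (1 + ‖x‖ ^ 2) ^ ((1 / 2 : ℝ) / 2) with hy
    have hy0 : 0 ≤ y := by positivity
    have hy4 : y ^ 4 = 1 + x ^ 2 := by
      rw [hy, ← Real.rpow_natCast, ← Real.rpow_mul (by positivity)]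
      norm_num
    refine Real.sqrt_le_iff.2 ⟨by positivity, ?_⟩
    refine le_of_sq_le_sq ?_ (by positivity)
    have : ((2 * y) ^ 2) ^ 2 = 16 * (1 + x ^ 2) := by rw [← hy4]; ring
    rw [this]
    nlinarith [sq_abs x, sq_nonneg (|x| - 1)]

/-- Interpolation between `L²` and `L^∞`. -/
theorem eLpNorm_le_of_ae_enorm_le {u : ℝ → ℂ} {B : ℝ≥0∞} (hB : ∀ᵐ x, ‖u x‖ₑ ≤ B)
    (hBt : B ≠ ⊤) {q : ℝ}
    (hq : 2 < q) :
    eLpNorm u (ENNReal.ofReal q) volume ≤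
      (B ^ (q - 2) * eLpNorm u 2 volume ^ 2) ^ (1 / q) := by
  have hq0 : ENNReal.ofReal q ≠ 0 := by simp; linarith
  rw [eLpNorm_eq_lintegral_rpow_enorm_toReal hq0 ENNReal.ofReal_ne_top,
    ENNReal.toReal_ofReal (by linarith)]
  refine ENNReal.rpow_le_rpow ?_ (by positivity)
  have h2 : eLpNorm u 2 volume ^ 2 = ∫⁻ x, ‖u x‖ₑ ^ (2 : ℝ) := by
    rw [eLpNorm_eq_lintegral_rpow_enorm_toReal (by norm_num) (by norm_num), ← ENNReal.rpow_natCast,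
      ← ENNReal.rpow_mul]
    norm_num
  rw [h2]
  calc ∫⁻ x, ‖u x‖ₑ ^ q ≤ ∫⁻ x, B ^ (q - 2) * ‖u x‖ₑ ^ (2 : ℝ) := by
        refine lintegral_mono_ae ?_
        filter_upwards [hB] with x hx
        have : ‖u x‖ₑ ^ q = ‖u x‖ₑ ^ (q - 2) * ‖u x‖ₑ ^ (2 : ℝ) := by
          rw [← ENNReal.rpow_add_of_nonneg _ _ (by linarith) (by norm_num)]
          ring_nf
        rw [this]
        gcongr
    _ ≤ B ^ (q - 2) * ∫⁻ x, ‖u x‖ₑ ^ (2 : ℝ) := by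
        rw [lintegral_const_mul' _ _ (ENNReal.rpow_ne_top_of_nonneg (by linarith) hBt)]

/-- The dyadic shell `2 ^ k ≤ 1 + |ξ| < 2 ^ (k + 1)`. -/
def freqShell (k : ℕ) : Set ℝ := {ξ | (2 : ℝ) ^ k ≤ 1 + |ξ| ∧ 1 + |ξ| < 2 ^ (k + 1)}

theorem measurableSet_freqShell (k : ℕ) : MeasurableSet (freqShell k) := by
  have h1 : MeasurableSet {ξ : ℝ | (2 : ℝ) ^ k ≤ 1 + |ξ|} :=
    measurableSet_le measurable_const (by fun_prop)
  have h2 : MeasurableSet {ξ : ℝ | 1 + |ξ| < (2 : ℝ) ^ (k + 1)} :=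
    measurableSet_lt (by fun_prop) measurable_const
  exact h1.inter h2

theorem indicator_add_indicator_freqShell (a : ℝ → ℂ) (K : ℕ) (ξ : ℝ) :
    {ξ : ℝ | 1 + |ξ| < 2 ^ K}.indicator a ξ + (freqShell K).indicator a ξ =
      {ξ : ℝ | 1 + |ξ| < 2 ^ (K + 1)}.indicator a ξ := by
  have hmono : (2 : ℝ) ^ K ≤ 2 ^ (K + 1) := pow_le_pow_right₀ (by norm_num) (by omega)
  have hd : Disjoint {ξ : ℝ | 1 + |ξ| < 2 ^ K} (freqShell K) :=
    Set.disjoint_left.2 fun x (h1 : 1 + |x| < 2 ^ K) h2 => h1.not_ge h2.1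
  have hu : {ξ : ℝ | 1 + |ξ| < 2 ^ (K + 1)} = {ξ : ℝ | 1 + |ξ| < 2 ^ K} ∪ freqShell K := by
    ext x
    constructor
    · intro (h : 1 + |x| < 2 ^ (K + 1))
      rcases lt_or_ge (1 + |x|) (2 ^ K) with h1 | h1
      exacts [Or.inl h1, Or.inr ⟨h1, h⟩]
    · rintro (h | h)
      exacts [lt_of_lt_of_le (show 1 + |x| < 2 ^ K from h) hmono, h.2]
  rw [hu, Set.indicator_union_of_disjoint hd]

/-- The enclosing ball has length `2^{k+2} = (2·√2^k)²`; the bound is kept as a square because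
Cauchy–Schwarz takes its root. -/
theorem volume_freqShell_le (k : ℕ) :
    volume (freqShell k) ≤ ENNReal.ofReal (2 * Real.sqrt 2 ^ k) ^ (2 : ℝ) := by
  have hsub : freqShell k ⊆ Metric.ball (0 : ℝ) (2 ^ (k + 1)) := by
    intro ξ hξ
    rw [mem_ball_zero_iff, Real.norm_eq_abs]
    have := hξ.2
    linarith
  refine (measure_mono hsub).trans ?_
  rw [Real.volume_ball, ENNReal.ofReal_rpow_of_nonneg (by positivity) (by norm_num)]
  refine ENNReal.ofReal_le_ofReal (le_of_eq ?_)
  have : (Real.sqrt 2 ^ k) ^ 2 = 2 ^ k := by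
    rw [← pow_mul, mul_comm k, pow_mul, Real.sq_sqrt (by norm_num)]
  rw [Real.rpow_ofNat, mul_pow, this]
  ring

theorem le_sqrt_of_two_pow_le {k : ℕ} {ξ : ℝ} (h : (2 : ℝ) ^ k ≤ 1 + |ξ|) :
    Real.sqrt 2 ^ k ≤ Real.sqrt (1 + |ξ|) := by
  refine Real.le_sqrt_of_sq_le ?_
  rw [← pow_mul, mul_comm k, pow_mul, Real.sq_sqrt (by norm_num)]
  exact h

/-- High frequency cut-offs of an `H^{1/2}` function decay in `L²`. -/
theorem eLpNorm_indicator_le (a : ℝ → ℂ) {k : ℕ} {s : Set ℝ}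
    (hs : ∀ ξ ∈ s, (2 : ℝ) ^ k ≤ 1 + |ξ|) :
    eLpNorm (s.indicator a) 2 volume ≤ ENNReal.ofReal ((Real.sqrt 2)⁻¹ ^ k) *
      eLpNorm (fun ξ : ℝ => (Real.sqrt (1 + |ξ|) : ℂ) * a ξ) 2 volume := by
  refine eLpNorm_le_mul_eLpNorm_of_ae_le_mul (Eventually.of_forall fun ξ => ?_) _
  by_cases hξ : ξ ∈ s
  · rw [Set.indicator_of_mem hξ, norm_mul, Complex.norm_real,
      Real.norm_of_nonneg (Real.sqrt_nonneg _), ← mul_assoc]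
    refine le_mul_of_one_le_left (norm_nonneg _) ?_
    rw [inv_pow, ← div_eq_inv_mul, one_le_div (by positivity)]
    exact le_sqrt_of_two_pow_le (hs ξ hξ)
  · rw [Set.indicator_of_notMem hξ, norm_zero]
    positivity

theorem eLpNorm_fourierInv (h : Lp ℂ 2 (volume : Measure ℝ)) :
    eLpNorm (𝓕⁻ h : Lp ℂ 2 (volume : Measure ℝ)) 2 volume = eLpNorm h 2 volume := by
  rw [← Lp.enorm_def, ← Lp.enorm_def]
  have := Lp.norm_fourier_eq (𝓕⁻ h)
  rw [FourierTransform.fourier_fourierInv_eq] at this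
  rw [← ofReal_norm, ← ofReal_norm, this]

/-- The `L^q` estimate for a dyadic frequency block. -/
theorem eLpNorm_fourierInv_shell_le {a : ℝ → ℂ} (ha : AEStronglyMeasurable a) {k : ℕ}
    {h : Lp ℂ 2 (volume : Measure ℝ)} (hh : h =ᵐ[volume] (freqShell k).indicator a)
    {A : ℝ≥0∞} (hA : eLpNorm (fun ξ : ℝ => (Real.sqrt (1 + |ξ|) : ℂ) * a ξ) 2 volume = A)
    (hAt : A ≠ ⊤) {q : ℝ} (hq : 2 < q) :
    eLpNorm (𝓕⁻ h : Lp ℂ 2 (volume : Measure ℝ)) (ENNReal.ofReal q) volume ≤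
      ((2 * A) ^ (q - 2) * A ^ 2) ^ (1 / q) *
        (ENNReal.ofReal (Real.sqrt 2)⁻¹ ^ (2 * (1 / q))) ^ k := by
  have hmem : ∀ ξ ∈ freqShell k, (2 : ℝ) ^ k ≤ 1 + |ξ| := fun ξ hξ => hξ.1
  have h2 : eLpNorm h 2 volume ≤ ENNReal.ofReal ((Real.sqrt 2)⁻¹ ^ k) * A := by
    rw [eLpNorm_congr_ae hh, ← hA]
    exact eLpNorm_indicator_le a hmem
  -- Cauchy–Schwarz on the shell: the growth `√2^k` of the root of its measure cancels the `L²`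
  -- decay `√2^{-k}`. The `L^∞` norm of each block is therefore bounded uniformly in `k`, and the
  -- decay in `L^q` comes from the `L²` factor alone.
  have h1 : eLpNorm h 1 volume ≤ 2 * A := by
    have e := eLpNorm_le_eLpNorm_mul_rpow_measure_univ (μ := volume.restrict (freqShell k))
      (p := 1) (q := 2) (f := a) (by norm_num) ha.restrict
    rw [← eLpNorm_indicator_eq_eLpNorm_restrict (measurableSet_freqShell k),
      ← eLpNorm_indicator_eq_eLpNorm_restrict (measurableSet_freqShell k),
      ← eLpNorm_congr_ae hh, ← eLpNorm_congr_ae hh, Measure.restrict_apply_univ] at e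
    refine e.trans ?_
    have hv : volume (freqShell k) ^ (1 / (1 : ℝ≥0∞).toReal - 1 / (2 : ℝ≥0∞).toReal) ≤
        ENNReal.ofReal (2 * Real.sqrt 2 ^ k) := by
      have e2 : (1 / (1 : ℝ≥0∞).toReal - 1 / (2 : ℝ≥0∞).toReal) = (2 : ℝ)⁻¹ := by norm_num
      rw [e2]
      refine (ENNReal.rpow_le_rpow (volume_freqShell_le k) (by norm_num)).trans ?_
      rw [← ENNReal.rpow_mul]
      norm_num
    refine (mul_le_mul' h2 hv).trans (le_of_eq ?_)
    rw [mul_right_comm, ← ENNReal.ofReal_mul (by positivity)]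
    have : (Real.sqrt 2)⁻¹ ^ k * (2 * Real.sqrt 2 ^ k) = 2 := by
      rw [inv_pow]; field_simp
    rw [this]
    norm_num
  have hint : Integrable h := memLp_one_iff_integrable.1
    ⟨(Lp.aestronglyMeasurable h), h1.trans_lt (by finiteness)⟩
  have hB : ∀ᵐ x, ‖(𝓕⁻ h : Lp ℂ 2 (volume : Measure ℝ)) x‖ₑ ≤ 2 * A := by
    filter_upwards [coe_fourierInv_ae_eq h hint] with x hx
    rw [hx]
    have hb := norm_fourierInv_le_integral_norm h x
    rw [integral_norm_eq_lintegral_enorm hint.1, ← eLpNorm_one_eq_lintegral_enorm] at hb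
    rw [← ofReal_norm]
    exact (ENNReal.ofReal_le_of_le_toReal hb).trans h1
  refine (eLpNorm_le_of_ae_enorm_le hB (by finiteness) hq).trans ?_
  rw [eLpNorm_fourierInv]
  have hexp : (ENNReal.ofReal (Real.sqrt 2)⁻¹ ^ (2 * (1 / q))) ^ k =
      ((ENNReal.ofReal ((Real.sqrt 2)⁻¹ ^ k)) ^ 2) ^ (1 / q) := by
    rw [ENNReal.ofReal_pow (by positivity), ← ENNReal.rpow_natCast, ← ENNReal.rpow_natCast,
      ← ENNReal.rpow_natCast, ← ENNReal.rpow_mul, ← ENNReal.rpow_mul, ← ENNReal.rpow_mul]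
    congr 1
    push_cast
    ring
  rw [hexp, ← ENNReal.mul_rpow_of_nonneg _ _ (by positivity)]
  refine ENNReal.rpow_le_rpow ?_ (by positivity)
  rw [mul_assoc, ← mul_pow, mul_comm A]
  gcongr

/-- The Sobolev embedding `H^{1/2}(ℝ) ⊂ L^q(ℝ)` for finite `q > 2`. -/
theorem memLp_of_half_sobolev {u : Lp ℂ 2 (volume : Measure ℝ)}
    (hu : MemLp (fun ξ : ℝ => (Real.sqrt (1 + |ξ|) : ℂ) * (𝓕 u : Lp ℂ 2 (volume : Measure ℝ)) ξ) 2)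
    {q : ℝ} (hq : 2 < q) : MemLp u (ENNReal.ofReal q) := by
  set a : Lp ℂ 2 (volume : Measure ℝ) := 𝓕 u with ha
  obtain ⟨A, hA⟩ : ∃ A, eLpNorm (fun ξ : ℝ => (Real.sqrt (1 + |ξ|) : ℂ) * a ξ) 2 volume = A :=
    ⟨_, rfl⟩
  have hAt : A ≠ ⊤ := hA ▸ hu.2.ne
  set h : ℕ → Lp ℂ 2 (volume : Measure ℝ) := fun k =>
    ((Lp.memLp a).indicator (measurableSet_freqShell k)).toLp _
  have hh : ∀ k, h k =ᵐ[volume] (freqShell k).indicator a := fun k => MemLp.coeFn_toLp _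
  set H : ℕ → Lp ℂ 2 (volume : Measure ℝ) := fun K => ∑ k ∈ Finset.range K, h k with hHdef
  have hHsucc : ∀ K, H (K + 1) = H K + h K := fun K => Finset.sum_range_succ _ _
  have hHae : ∀ K, H K =ᵐ[volume] {ξ : ℝ | 1 + |ξ| < 2 ^ K}.indicator a := by
    intro K
    induction K with
    | zero =>
      have h0 : H 0 = 0 := by simp [hHdef]
      rw [h0]
      filter_upwards [Lp.coeFn_zero ℂ 2 (volume : Measure ℝ)] with ξ hξ
      rw [hξ, Set.indicator_of_notMem]
      · rfl
      · simp
    | succ K ih =>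
      rw [hHsucc]
      filter_upwards [Lp.coeFn_add (H K) (h K), ih, hh K] with ξ e1 e2 e3
      rw [e1, Pi.add_apply, e2, e3, indicator_add_indicator_freqShell]
  have hHt : Tendsto H atTop (𝓝 a) := by
    rw [tendsto_iff_edist_tendsto_0]
    have hle : ∀ K, edist (H K) a ≤ ENNReal.ofReal ((Real.sqrt 2)⁻¹ ^ K) * A := by
      intro K
      rw [edist_comm, Lp.edist_def, ← hA]
      refine le_trans (le_of_eq ?_)
        (eLpNorm_indicator_le a (k := K) (s := {ξ : ℝ | 2 ^ K ≤ 1 + |ξ|}) fun ξ hξ => hξ)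
      refine eLpNorm_congr_ae ?_
      filter_upwards [hHae K] with ξ hξ
      rw [Pi.sub_apply, hξ]
      by_cases hc : 1 + |ξ| < 2 ^ K
      · rw [Set.indicator_of_mem (by exact hc), Set.indicator_of_notMem (by exact not_le.2 hc),
          sub_self]
      · rw [Set.indicator_of_notMem (by exact hc), Set.indicator_of_mem (by exact not_lt.1 hc),
          sub_zero]
    have hlim : Tendsto (fun K : ℕ => ENNReal.ofReal ((Real.sqrt 2)⁻¹ ^ K) * A) atTop (𝓝 0) := by
      have hr : (Real.sqrt 2)⁻¹ < 1 := inv_lt_one_of_one_lt₀ (by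
        rw [Real.lt_sqrt] <;> norm_num)
      have h1 := ENNReal.tendsto_ofReal
        (tendsto_pow_atTop_nhds_zero_of_lt_one (by positivity) hr)
      rw [ENNReal.ofReal_zero] at h1
      simpa using ENNReal.Tendsto.mul_const h1 (Or.inr hAt)
    exact tendsto_of_tendsto_of_tendsto_of_le_of_le tendsto_const_nhds hlim
      (fun _ => zero_le) hle
  have hS : Tendsto (fun K => 𝓕⁻ (H K)) atTop (𝓝 u) := by
    have := (ContinuousFourierInv.continuous_fourierInv.tendsto a).comp hHt
    rwa [ha, FourierTransform.fourierInv_fourier_eq] at this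
  set D := ((2 * A) ^ (q - 2) * A ^ 2) ^ (1 / q)
  -- The ratio is `2^{-1/q} < 1`, so the block bounds sum geometrically. The endpoint `q = ∞` would
  -- give ratio 1.
  set r := ENNReal.ofReal (Real.sqrt 2)⁻¹ ^ (2 * (1 / q)) with hr
  have hDt : D ≠ ⊤ := by
    refine ENNReal.rpow_ne_top_of_nonneg (by positivity) (ENNReal.mul_ne_top ?_ (by finiteness))
    exact ENNReal.rpow_ne_top_of_nonneg (by linarith) (by finiteness)
  have hr1 : r < 1 := by
    refine ENNReal.rpow_lt_one ?_ (by positivity)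
    rw [ENNReal.ofReal_lt_one]
    exact inv_lt_one_of_one_lt₀ (by rw [Real.lt_sqrt] <;> norm_num)
  have hq1 : (1 : ℝ≥0∞) ≤ ENNReal.ofReal q := by
    rw [← ENNReal.ofReal_one]
    exact ENNReal.ofReal_le_ofReal (by linarith)
  have hsum : ∀ K, eLpNorm (𝓕⁻ (H K) : Lp ℂ 2 (volume : Measure ℝ)) (ENNReal.ofReal q) volume ≤
      ∑ k ∈ Finset.range K, D * r ^ k := by
    intro K
    induction K with
    | zero =>
      have h0 : (𝓕⁻ (H 0) : Lp ℂ 2 (volume : Measure ℝ)) = 0 := by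
        simp only [hHdef, Finset.range_zero, Finset.sum_empty]
        exact FourierTransform.fourierInv_zero
      rw [h0, eLpNorm_congr_ae (Lp.coeFn_zero ℂ 2 (volume : Measure ℝ))]
      simp
    | succ K ih =>
      rw [hHsucc, FourierTransform.fourierInv_add, eLpNorm_congr_ae (Lp.coeFn_add _ _),
        Finset.sum_range_succ]
      refine (eLpNorm_add_le (Lp.aestronglyMeasurable _) (Lp.aestronglyMeasurable _) hq1).trans
        (add_le_add ih ?_)
      exact eLpNorm_fourierInv_shell_le (Lp.aestronglyMeasurable a) (hh K) hA hAt hq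
  have hbound : ∀ K, eLpNorm (𝓕⁻ (H K) : Lp ℂ 2 (volume : Measure ℝ)) (ENNReal.ofReal q) volume ≤
      D * (1 - r)⁻¹ := by
    intro K
    refine (hsum K).trans ((ENNReal.sum_le_tsum _).trans (le_of_eq ?_))
    rw [ENNReal.tsum_mul_left, ENNReal.tsum_geometric]
  -- The partial sums converge to `u` only in `L²`; an a.e. convergent subsequence and Fatou
  -- transfer the uniform `L^q` bound.
  obtain ⟨ns, -, hns⟩ := (tendstoInMeasure_of_tendsto_Lp hS).exists_seq_tendsto_ae
  refine ⟨Lp.aestronglyMeasurable u, ?_⟩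
  refine (Lp.eLpNorm_lim_le_liminf_eLpNorm
    (fun n => Lp.aestronglyMeasurable (𝓕⁻ (H (ns n)))) u hns).trans_lt ?_
  refine lt_of_le_of_lt (liminf_le_of_frequently_le'
    (Frequently.of_forall fun n => hbound (ns n))) ?_
  refine ENNReal.mul_lt_top hDt.lt_top (ENNReal.inv_lt_top.2 ?_)
  exact tsub_pos_of_lt hr1

/-! ### Growth of the homogeneous nonlinearity. -/

/-- A differentiable solution of Euler's relation is a power on the positive half-line. -/
theorem homogeneous_eq_of_pos {p : ℝ} {f : ℝ → ℝ} (hf : Differentiable ℝ f)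
    (hom : ∀ s : ℝ, s * deriv f s = p * f s) {s : ℝ} (hs : 0 < s) : f s = f 1 * s ^ p := by
  -- In the variable `t = log s`, Euler's relation says that `f(e^t)e^{-pt}` is constant.
  have hd : ∀ t : ℝ, HasDerivAt (fun t => f (Real.exp t) * Real.exp (-(p * t))) 0 t := by
    intro t
    have h1 : HasDerivAt (fun t => f (Real.exp t)) (deriv f (Real.exp t) * Real.exp t) t :=
      (hf (Real.exp t)).hasDerivAt.comp t (Real.hasDerivAt_exp t)
    have h2 : HasDerivAt (fun t => Real.exp (-(p * t))) (Real.exp (-(p * t)) * -p) t := by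
      have := ((hasDerivAt_id t).const_mul p).neg.exp
      simpa using this
    refine (h1.mul h2).congr_deriv ?_
    have := hom (Real.exp t)
    linear_combination Real.exp (-(p * t)) * this
  have hc := is_const_of_deriv_eq_zero (fun t => (hd t).differentiableAt) (fun t => (hd t).deriv)
    (Real.log s) 0
  simp only [Real.exp_log hs, mul_zero, neg_zero, Real.exp_zero, mul_one] at hc
  rw [← hc, Real.rpow_def_of_pos hs, mul_assoc, ← Real.exp_add]
  rw [show -(p * Real.log s) + Real.log s * p = 0 by ring, Real.exp_zero, mul_one]

theorem homogeneous_abs_le {p : ℝ} (hp : 0 < p) {f : ℝ → ℝ} (hf : Differentiable ℝ f)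
    (hom : ∀ s : ℝ, s * deriv f s = p * f s) :
    ∃ C, 0 ≤ C ∧ ∀ s, |f s| ≤ C * |s| ^ p := by
  refine ⟨max |f 1| |f (-1)|, le_max_of_le_left (abs_nonneg _), fun s => ?_⟩
  rcases lt_trichotomy s 0 with hs | rfl | hs
  -- Euler's relation is invariant under reflection, which reduces the negative half-line to the
  -- positive one with constant `f(-1)`.
  · have hom' : ∀ s : ℝ, s * deriv (fun x => f (-x)) s = p * f (-s) := by
      intro s
      rw [deriv_comp_neg, ← hom (-s)]
      ring
    have h := homogeneous_eq_of_pos (hf.comp differentiable_neg) hom' (neg_pos.2 hs)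
    simp only [Function.comp_apply, neg_neg] at h
    rw [h, abs_mul, abs_of_neg hs, abs_of_nonneg (Real.rpow_nonneg (neg_pos.2 hs).le p)]
    exact mul_le_mul_of_nonneg_right (le_max_right _ _) (Real.rpow_nonneg (neg_pos.2 hs).le p)
  · have : f 0 = 0 := by
      have := hom 0
      rw [zero_mul, eq_comm, mul_eq_zero] at this
      exact this.resolve_left hp.ne'
    rw [this, abs_zero, Real.zero_rpow hp.ne']
    simp
  · rw [homogeneous_eq_of_pos hf hom hs, abs_mul, abs_of_pos hs,
      abs_of_nonneg (Real.rpow_nonneg hs.le p)]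
    exact mul_le_mul_of_nonneg_right (le_max_left _ _) (Real.rpow_nonneg hs.le p)

theorem memLp_two_of_abs_le_rpow {p C : ℝ} (hp : 0 < p) {f : ℝ → ℝ} (hf : Continuous f)
    (hC : ∀ s, |f s| ≤ C * |s| ^ p) {φ : ℝ → ℝ} (hφ : MemLp φ (ENNReal.ofReal (2 * p)) volume) :
    MemLp (fun x => f (φ x)) 2 volume := by
  have h := hφ.norm_rpow_div (ENNReal.ofReal p)
  have e : ENNReal.ofReal (2 * p) / ENNReal.ofReal p = 2 := by
    rw [← ENNReal.ofReal_div_of_pos hp, mul_div_assoc, div_self hp.ne']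
    norm_num
  rw [e, ENNReal.toReal_ofReal hp.le] at h
  refine h.of_le_mul (c := C) (hf.comp_aestronglyMeasurable hφ.1)
    (Eventually.of_forall fun x => ?_)
  rw [Real.norm_eq_abs, Real.norm_of_nonneg (by positivity), Real.norm_eq_abs]
  exact hC _

/-! ### Integration by parts for the nonlinear term in `H¹`. -/

/-- Weighted `L²` pairings are jointly continuous. -/
theorem tendsto_integral_mul_mul {m : ℝ → ℝ} (hm : MemLp m ⊤ volume) {a b : ℕ → L2R} {a₀ b₀ : L2R}
    (ha : Tendsto a atTop (𝓝 a₀)) (hb : Tendsto b atTop (𝓝 b₀)) :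
    Tendsto (fun n => ∫ x, m x * a n x * b n x) atTop (𝓝 (∫ x, m x * a₀ x * b₀ x)) := by
  set W : L2R →L[ℝ] L2R :=
    (ContinuousLinearMap.mul ℝ ℝ).holderL volume ⊤ 2 2 (hm.toLp m)
  set B := (ContinuousLinearMap.mul ℝ ℝ).lpPairing (volume : Measure ℝ) 2 2
  have hB : ∀ u v : L2R, B (W u) v = ∫ x, m x * u x * v x := by
    intro u v
    simp only [B, ContinuousLinearMap.lpPairing_eq_integral]
    refine integral_congr_ae ?_
    filter_upwards [hm.coeFn_toLp, ContinuousLinearMap.coeFn_holder (r := 2)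
      (ContinuousLinearMap.mul ℝ ℝ) (hm.toLp m) u] with x h1 h2
    rw [ContinuousLinearMap.mul_apply']
    congr 1
    refine Eq.trans h2 ?_
    rw [ContinuousLinearMap.mul_apply', h1]
  simp_rw [← hB]
  have h1 : Tendsto (fun n => B (W (a n))) atTop (𝓝 (B (W a₀))) :=
    (B.continuous.tendsto _).comp ((W.continuous.tendsto _).comp ha)
  exact (isBoundedBilinearMap_apply.continuous.tendsto (B (W a₀), b₀)).comp (h1.prodMk_nhds hb)

/-- Integration by parts for the nonlinear term against a modulated derivative, for Schwartz
functions. -/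
theorem integral_sin_mul_comp_mul_deriv_schwartz {f F : ℝ → ℝ} {L R : ℝ}
    (hfc : Continuous f) (hL0 : 0 ≤ L)
    (hF : ∀ s, HasDerivAt F (f s) s) (hL : ∀ s, |s| ≤ R → |f s| ≤ L * |s|)
    (hFL : ∀ s, |s| ≤ R → |F s| ≤ L * |s|) (d : 𝓢(ℝ, ℝ)) (hd : ∀ x, |d x| ≤ R) (ω : ℝ) :
    ∫ x, Real.sin (ω * x) * f (d x) * deriv d x = -ω * ∫ x, Real.cos (ω * x) * F (d x) := by
  have hFc : Continuous F := continuous_iff_continuousAt.2 fun s => (hF s).continuousAt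
  have h : ∀ x, HasDerivAt (fun x => Real.sin (ω * x) * F (d x))
      (ω * (Real.cos (ω * x) * F (d x)) + Real.sin (ω * x) * f (d x) * deriv d x) x := by
    intro x
    have h1 : HasDerivAt (fun x => Real.sin (ω * x)) (Real.cos (ω * x) * ω) x := by
      have := ((hasDerivAt_id x).const_mul ω).sin
      simpa using this
    have h2 : HasDerivAt (fun x => F (d x)) (f (d x) * deriv d x) x :=
      (hF (d x)).comp x (d.hasDerivAt x)
    exact (h1.mul h2).congr_deriv (by ring)
  have hFi : Integrable fun x => F (d x) := by
    refine (d.integrable.norm.const_mul L).mono' (hFc.comp d.continuous).aestronglyMeasurable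
      (Eventually.of_forall fun x => ?_)
    exact hFL _ (hd x)
  have i1 : Integrable fun x => Real.sin (ω * x) * F (d x) :=
    hFi.bdd_mul (c := 1) (by fun_prop) (Eventually.of_forall fun x => Real.abs_sin_le_one _)
  have i2 : Integrable fun x => Real.cos (ω * x) * F (d x) :=
    hFi.bdd_mul (c := 1) (by fun_prop) (Eventually.of_forall fun x => Real.abs_cos_le_one _)
  have i3 : Integrable fun x => Real.sin (ω * x) * f (d x) * deriv d x := by
    have hdi : Integrable (deriv d) := (SchwartzMap.derivCLM ℝ ℝ d).integrable
    refine hdi.bdd_mul (c := L * R) ?_ (Eventually.of_forall fun x => ?_)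
    · exact Continuous.aestronglyMeasurable (by
        have := d.continuous
        fun_prop)
    · rw [norm_mul]
      have h1 : |f (d x)| ≤ L * R := (hL _ (hd x)).trans (mul_le_mul_of_nonneg_left (hd x) hL0)
      calc ‖Real.sin (ω * x)‖ * ‖f (d x)‖ ≤ 1 * (L * R) :=
            mul_le_mul (Real.abs_sin_le_one _) h1 (norm_nonneg _) zero_le_one
        _ = L * R := one_mul _
  have hz := integral_eq_zero_of_hasDerivAt_of_integrable h ((i2.const_mul ω).add i3) i1
  rw [integral_add (i2.const_mul ω) i3, integral_const_mul] at hz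
  linarith

/-- Multiplication by a bounded function is continuous on `L²`. -/
theorem tendsto_of_ae_eq_mul {m : ℝ → ℂ} (hm : MemLp m ⊤ volume)
    {g G : ℕ → Lp ℂ 2 (volume : Measure ℝ)} {g₀ G₀ : Lp ℂ 2 (volume : Measure ℝ)}
    (hg : Tendsto g atTop (𝓝 g₀)) (hG : ∀ n, G n =ᵐ[volume] fun x => m x * g n x)
    (hG₀ : G₀ =ᵐ[volume] fun x => m x * g₀ x) : Tendsto G atTop (𝓝 G₀) := by
  set W : Lp ℂ 2 (volume : Measure ℝ) →L[ℂ] Lp ℂ 2 (volume : Measure ℝ) :=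
    (ContinuousLinearMap.mul ℂ ℂ).holderL volume ⊤ 2 2 (hm.toLp m)
  have hW : ∀ u G : Lp ℂ 2 (volume : Measure ℝ), (G =ᵐ[volume] fun x => m x * u x) → G = W u := by
    intro u G h
    refine Lp.ext ?_
    filter_upwards [h, hm.coeFn_toLp, ContinuousLinearMap.coeFn_holder (r := 2)
      (ContinuousLinearMap.mul ℂ ℂ) (hm.toLp m) u] with x h0 h1 h2
    rw [h0]
    refine Eq.symm (Eq.trans h2 ?_)
    rw [ContinuousLinearMap.mul_apply', h1]
  rw [hW g₀ G₀ hG₀]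
  exact ((W.continuous.tendsto _).comp hg).congr fun n => (hW (g n) (G n) (hG n)).symm

theorem integral_norm_sq_eq (u : Lp ℂ 2 (volume : Measure ℝ)) : ∫ x, ‖u x‖ ^ 2 = ‖u‖ ^ 2 := by
  have h := inner_self_eq_norm_sq (𝕜 := ℂ) u
  rw [L2.inner_def] at h
  rw [← h, ← integral_re (L2.integrable_inner u u)]
  refine integral_congr_ae (Eventually.of_forall fun x => ?_)
  exact (inner_self_eq_norm_sq (𝕜 := ℂ) (u x)).symm

theorem integrable_norm_sq_Lp (u : Lp ℂ 2 (volume : Measure ℝ)) :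
    Integrable fun x => ‖u x‖ ^ 2 :=
  (memLp_two_iff_integrable_sq_norm (Lp.aestronglyMeasurable u)).1 (Lp.memLp u)

/-- Approximation in `H¹` by Schwartz functions that are uniformly bounded. -/
theorem exists_schwartz_approx {u D : Lp ℂ 2 (volume : Measure ℝ)}
    (hD : (𝓕 D : Lp ℂ 2 (volume : Measure ℝ)) =ᵐ[volume] fun ξ : ℝ =>
      2 * Real.pi * Complex.I * ξ * (𝓕 u : Lp ℂ 2 (volume : Measure ℝ)) ξ) :
    ∃ (w : ℕ → 𝓢(ℝ, ℂ)) (R : ℝ), Tendsto (fun n => (w n).toLp 2 volume) atTop (𝓝 u) ∧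
      Tendsto (fun n => (SchwartzMap.derivCLM ℂ ℂ (w n)).toLp 2 volume) atTop (𝓝 D) ∧
      ∀ n x, ‖w n x‖ ≤ R := by
  set a : Lp ℂ 2 (volume : Measure ℝ) := 𝓕 u with ha
  set b : Lp ℂ 2 (volume : Measure ℝ) := 𝓕 D with hb
  -- The `H¹` Bessel multiplier. Approximating `√(1+ξ²)·a` in `L²` by Schwartz `g n` and setting
  -- `𝓕(w n) = κ·g n` gives convergence of both `w n` and its derivative, since `κ` and `ξκ` are
  -- bounded.
  set κ : ℝ → ℂ := fun ξ => (((1 + ‖ξ‖ ^ 2) ^ (-(1 / 2) : ℝ) : ℝ) : ℂ) with hκ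
  have hκg : κ.HasTemperateGrowth := by fun_prop
  have hκn : ∀ ξ, ‖κ ξ‖ = (Real.sqrt (1 + ξ ^ 2))⁻¹ := fun ξ => by
    rw [hκ]
    simp only
    rw [Complex.norm_real, Real.norm_of_nonneg (by positivity), Real.rpow_neg (by positivity),
      ← Real.sqrt_eq_rpow, Real.norm_eq_abs, sq_abs]
  have hs1 : ∀ ξ : ℝ, 1 ≤ Real.sqrt (1 + ξ ^ 2) := fun ξ => by
    rw [Real.one_le_sqrt]; nlinarith [sq_nonneg ξ]
  have hsξ : ∀ ξ : ℝ, |ξ| ≤ Real.sqrt (1 + ξ ^ 2) := fun ξ => by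
    rw [← Real.sqrt_sq_eq_abs]; exact Real.sqrt_le_sqrt (by linarith)
  have hκm : MemLp κ ⊤ volume := by
    refine memLp_top_of_bound hκg.1.continuous.aestronglyMeasurable 1
      (Eventually.of_forall fun ξ => ?_)
    rw [hκn]
    exact inv_le_one_of_one_le₀ (hs1 ξ)
  have hκ'm : MemLp (fun ξ : ℝ => 2 * Real.pi * Complex.I * ξ * κ ξ) ⊤ volume := by
    refine memLp_top_of_bound (Continuous.aestronglyMeasurable (by
      have := hκg.1.continuous
      fun_prop)) (2 * Real.pi) (Eventually.of_forall fun ξ => ?_)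
    rw [norm_mul, hκn, norm_mul]
    have h1 : ‖(2 * Real.pi * Complex.I : ℂ)‖ = 2 * Real.pi := by
      simp [abs_of_pos Real.pi_pos]
    rw [h1, Complex.norm_real, Real.norm_eq_abs, mul_assoc]
    refine mul_le_of_le_one_right Real.two_pi_pos.le ?_
    rw [mul_inv_le_iff₀ (by have := hs1 ξ; linarith), one_mul]
    exact hsξ ξ
  have hHm : MemLp (fun ξ : ℝ => (Real.sqrt (1 + ξ ^ 2) : ℂ) * a ξ) 2 volume := by
    have hsum : MemLp (fun ξ => ‖a ξ‖ + ‖b ξ‖) 2 volume := (Lp.memLp a).norm.add (Lp.memLp b).norm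
    refine hsum.of_le_mul (c := 1) ((Continuous.aestronglyMeasurable (by fun_prop)).mul
      (Lp.aestronglyMeasurable a)) ?_
    filter_upwards [hD] with ξ hξ
    rw [hξ, one_mul, norm_mul, norm_mul, norm_mul, Complex.norm_real, Complex.norm_real,
      Real.norm_of_nonneg (Real.sqrt_nonneg _), Real.norm_of_nonneg (by positivity)]
    have h1 : ‖(2 * Real.pi * Complex.I : ℂ)‖ = 2 * Real.pi := by
      simp [abs_of_pos Real.pi_pos]
    have h2 : Real.sqrt (1 + ξ ^ 2) ≤ 1 + 2 * Real.pi * |ξ| := by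
      refine Real.sqrt_le_iff.2 ⟨by positivity, ?_⟩
      have h3 : 1 ≤ 2 * Real.pi := by linarith [Real.two_le_pi]
      have h4 : |ξ| ≤ 2 * Real.pi * |ξ| := le_mul_of_one_le_left (abs_nonneg _) h3
      nlinarith [sq_abs ξ, abs_nonneg ξ]
    rw [h1, Real.norm_eq_abs]
    nlinarith [norm_nonneg (a ξ)]
  set H : Lp ℂ 2 (volume : Measure ℝ) := hHm.toLp _
  have hH : H =ᵐ[volume] fun ξ : ℝ => (Real.sqrt (1 + ξ ^ 2) : ℂ) * a ξ := hHm.coeFn_toLp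
  have hκs : ∀ ξ : ℝ, κ ξ * (Real.sqrt (1 + ξ ^ 2) : ℂ) = 1 := fun ξ => by
    have h1 : κ ξ = (((Real.sqrt (1 + ξ ^ 2))⁻¹ : ℝ) : ℂ) := by
      rw [hκ]
      simp only
      rw [Real.rpow_neg (by positivity), ← Real.sqrt_eq_rpow, Real.norm_eq_abs, sq_abs]
    rw [h1, ← Complex.ofReal_mul, inv_mul_cancel₀ (by have := hs1 ξ; positivity), Complex.ofReal_one]
  have hdense : DenseRange (SchwartzMap.toLpCLM ℂ (E := ℝ) ℂ 2 volume) :=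
    SchwartzMap.denseRange_toLpCLM ENNReal.ofNat_ne_top
  obtain ⟨x, hx, hxH⟩ := mem_closure_iff_seq_limit.1 (hdense H)
  choose g hg using hx
  have hgH : Tendsto (fun n => (g n).toLp 2 volume) atTop (𝓝 H) := by
    refine hxH.congr fun n => ?_
    rw [← hg n]
    rfl
  set w : ℕ → 𝓢(ℝ, ℂ) := fun n => 𝓕⁻ (SchwartzMap.smulLeftCLM ℂ κ (g n))
  have hFw : ∀ n, 𝓕 (w n) = SchwartzMap.smulLeftCLM ℂ κ (g n) := fun n =>
    FourierTransform.fourier_fourierInv_eq _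
  have hFwx : ∀ n ξ, (𝓕 (w n) : 𝓢(ℝ, ℂ)) ξ = κ ξ * g n ξ := fun n ξ => by
    rw [hFw, SchwartzMap.smulLeftCLM_apply_apply hκg, smul_eq_mul]
  have t1 : Tendsto (fun n => (𝓕 (w n) : 𝓢(ℝ, ℂ)).toLp 2 volume) atTop (𝓝 a) := by
    refine tendsto_of_ae_eq_mul hκm hgH (fun n => ?_) ?_
    · filter_upwards [(𝓕 (w n) : 𝓢(ℝ, ℂ)).coeFn_toLp 2 volume, (g n).coeFn_toLp 2 volume]
        with ξ h1 h2
      rw [h1, h2, hFwx]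
    · filter_upwards [hH] with ξ h
      rw [h, ← mul_assoc, hκs, one_mul]
  have t2 : Tendsto (fun n => (𝓕 (SchwartzMap.derivCLM ℂ ℂ (w n)) : 𝓢(ℝ, ℂ)).toLp 2 volume) atTop
      (𝓝 b) := by
    refine tendsto_of_ae_eq_mul hκ'm hgH (fun n => ?_) ?_
    · filter_upwards [(𝓕 (SchwartzMap.derivCLM ℂ ℂ (w n)) : 𝓢(ℝ, ℂ)).coeFn_toLp 2 volume,
        (g n).coeFn_toLp 2 volume] with ξ h1 h2
      rw [h1, h2, fourier_deriv_schwartz, hFwx, ← mul_assoc]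
    · filter_upwards [hH, hD] with ξ h h'
      rw [h', h, ← mul_assoc, mul_assoc _ (κ ξ), hκs, mul_one]
  have hinv : ∀ (v : ℕ → 𝓢(ℝ, ℂ)) (z : Lp ℂ 2 (volume : Measure ℝ)),
      Tendsto (fun n => (𝓕 (v n) : 𝓢(ℝ, ℂ)).toLp 2 volume) atTop (𝓝 (𝓕 z)) →
      Tendsto (fun n => (v n).toLp 2 volume) atTop (𝓝 z) := by
    intro v z h
    have := (ContinuousFourierInv.continuous_fourierInv.tendsto (𝓕 z)).comp h
    rw [FourierTransform.fourierInv_fourier_eq] at this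
    refine this.congr fun n => ?_
    rw [Function.comp_apply, SchwartzMap.toLp_fourierInv_eq,
      FourierTransform.fourierInv_fourier_eq]
  obtain ⟨B, hB⟩ := (hgH.norm.bddAbove_range)
  have hκi : Integrable fun ξ : ℝ => (1 + ξ ^ 2)⁻¹ := integrable_inv_one_add_sq
  refine ⟨w, (∫ ξ : ℝ, (1 + ξ ^ 2)⁻¹) + B ^ 2, hinv _ _ t1, hinv _ _ t2, fun n x => ?_⟩
  have hwx : w n x = 𝓕⁻ ((𝓕 (w n) : 𝓢(ℝ, ℂ)) : ℝ → ℂ) x := by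
    rw [← SchwartzMap.fourierInv_coe, FourierTransform.fourierInv_fourier_eq]
  rw [hwx]
  refine (norm_fourierInv_le_integral_norm _ x).trans ?_
  have hgi := integrable_norm_sq_Lp ((g n).toLp 2 volume)
  have hBn : ‖(g n).toLp 2 volume‖ ^ 2 ≤ B ^ 2 :=
    pow_le_pow_left₀ (norm_nonneg _) (hB ⟨n, rfl⟩) 2
  rw [← integral_norm_sq_eq] at hBn
  -- The uniform bound: `κ` is square integrable, so `|κg| ≤ κ² + |g|²` controls the `L¹` norm of
  -- `𝓕(w n)`, hence the supremum of `w n`.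
  calc ∫ ξ, ‖(𝓕 (w n) : 𝓢(ℝ, ℂ)) ξ‖ ≤ ∫ ξ : ℝ, ((1 + ξ ^ 2)⁻¹ + ‖(g n).toLp 2 volume ξ‖ ^ 2) := by
        refine integral_mono_ae (𝓕 (w n) : 𝓢(ℝ, ℂ)).integrable.norm (hκi.add hgi) ?_
        filter_upwards [(g n).coeFn_toLp 2 volume] with ξ h
        rw [h, hFwx, norm_mul, hκn]
        have e : (1 + ξ ^ 2)⁻¹ = ((Real.sqrt (1 + ξ ^ 2))⁻¹) ^ 2 := by
          rw [inv_pow, Real.sq_sqrt (by positivity)]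
        rw [e]
        nlinarith [sq_nonneg ((Real.sqrt (1 + ξ ^ 2))⁻¹ - ‖g n ξ‖), norm_nonneg (g n ξ),
          inv_nonneg.2 (Real.sqrt_nonneg (1 + ξ ^ 2))]
    _ = (∫ ξ : ℝ, (1 + ξ ^ 2)⁻¹) + ∫ ξ, ‖(g n).toLp 2 volume ξ‖ ^ 2 := integral_add hκi hgi
    _ ≤ _ := by linarith

/-- Integration by parts for the nonlinear term against a modulated derivative, for `H¹`
functions. -/
theorem integral_sin_mul_comp_mul_deriv {f : ℝ → ℝ} {κ : ℝ} (hf : ContDiff ℝ 1 f) (hf0 : f 0 = 0)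
    (hF : ∀ s, HasDerivAt (fun s => κ * (s * f s)) (f s) s) {φ g : L2R}
    (hg : g =ᵐ[volume] fun x => f (φ x)) {D : Lp ℂ 2 (volume : Measure ℝ)}
    (hD : (𝓕 D : Lp ℂ 2 (volume : Measure ℝ)) =ᵐ[volume] fun ξ : ℝ =>
      2 * Real.pi * Complex.I * ξ * (𝓕 (toComplex φ) : Lp ℂ 2 (volume : Measure ℝ)) ξ) (ω : ℝ) :
    ∫ x, Real.sin (ω * x) * g x * (D x).re =
      -ω * (κ * ∫ x, Real.cos (ω * x) * φ x * g x) := by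
  obtain ⟨w, R, hw, hw', hR⟩ := exists_schwartz_approx hD
  have hR0 : 0 ≤ R := (norm_nonneg _).trans (hR 0 0)
  -- All approximants take values of modulus at most `R`, where `f` is Lipschitz. Extending `f` from
  -- `[-R, R]` to a globally Lipschitz function makes composition continuous on `L²`.
  obtain ⟨K, hK⟩ : ∃ K : NNReal, LipschitzOnWith K f (Set.Icc (-R) R) := by
    obtain ⟨C, hC⟩ := (isCompact_Icc (a := -R) (b := R)).exists_bound_of_continuousOn
      (hf.continuous_deriv le_rfl).continuousOn
    have hC0 : 0 ≤ C := (norm_nonneg _).trans (hC 0 ⟨by linarith, hR0⟩)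
    refine ⟨⟨C, hC0⟩, (convex_Icc _ _).lipschitzOnWith_of_nnnorm_deriv_le
      (fun x _ => (hf.differentiable one_ne_zero).differentiableAt) fun x hx => hC x hx⟩
  obtain ⟨f', hf'L, hf'⟩ := hK.extend_real
  have hf'0 : f' 0 = 0 := by rw [← hf' ⟨by linarith, hR0⟩, hf0]
  have hfK : ∀ s, |s| ≤ R → |f s| ≤ K * |s| := fun s hs => by
    have := hK.dist_le_mul s (abs_le.1 hs) 0 ⟨by linarith, hR0⟩
    rwa [hf0, Real.dist_0_eq_abs, Real.dist_0_eq_abs] at this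
  have hFK : ∀ s, |s| ≤ R → |κ * (s * f s)| ≤ |κ| * R * K * |s| := fun s hs => by
    rw [abs_mul, abs_mul, mul_assoc, mul_assoc]
    refine mul_le_mul_of_nonneg_left ?_ (abs_nonneg _)
    exact mul_le_mul hs (hfK s hs) (abs_nonneg _) hR0
  set d : ℕ → 𝓢(ℝ, ℝ) := fun n => SchwartzMap.postcompCLM Complex.reCLM (w n)
  have hdR : ∀ n x, |d n x| ≤ R := fun n x => (Complex.abs_re_le_norm _).trans (hR n x)
  have hdd : ∀ n x, deriv (d n) x = (SchwartzMap.derivCLM ℂ ℂ (w n) x).re := fun n x => by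
    rw [SchwartzMap.derivCLM_apply]
    exact (Complex.reCLM.hasFDerivAt.comp_hasDerivAt x ((w n).hasDerivAt x)).deriv
  set re : Lp ℂ 2 (volume : Measure ℝ) →L[ℝ] L2R := Complex.reCLM.compLpL 2 volume
  have hre : ∀ z : Lp ℂ 2 (volume : Measure ℝ), re z =ᵐ[volume] fun x => (z x).re := fun z =>
    ContinuousLinearMap.coeFn_compLpL Complex.reCLM z
  have hreφ : re (toComplex φ) = φ := by
    refine Lp.ext ?_
    filter_upwards [hre (toComplex φ), coe_toComplex φ] with x h1 h2
    rw [h1, h2, Complex.ofReal_re]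
  have hdn : ∀ n, re ((w n).toLp 2 volume) =ᵐ[volume] d n := fun n => by
    filter_upwards [hre ((w n).toLp 2 volume), (w n).coeFn_toLp 2 volume] with x h1 h2
    rw [h1, h2]
    rfl
  have hdn' : ∀ n, re ((SchwartzMap.derivCLM ℂ ℂ (w n)).toLp 2 volume) =ᵐ[volume]
      deriv (d n) := fun n => by
    filter_upwards [hre ((SchwartzMap.derivCLM ℂ ℂ (w n)).toLp 2 volume),
      (SchwartzMap.derivCLM ℂ ℂ (w n)).coeFn_toLp 2 volume] with x h1 h2
    rw [h1, h2, hdd]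
  have tφ : Tendsto (fun n => re ((w n).toLp 2 volume)) atTop (𝓝 φ) := by
    have := (re.continuous.tendsto _).comp hw
    rwa [hreφ] at this
  have tD : Tendsto (fun n => re ((SchwartzMap.derivCLM ℂ ℂ (w n)).toLp 2 volume)) atTop
      (𝓝 (re D)) := (re.continuous.tendsto _).comp hw'
  have hφR : ∀ᵐ x, |φ x| ≤ R := by
    obtain ⟨ns, -, hns⟩ := (tendstoInMeasure_of_tendsto_Lp tφ).exists_seq_tendsto_ae
    have hall : ∀ᵐ x, ∀ n, re ((w n).toLp 2 volume) x = d n x := ae_all_iff.2 hdn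
    filter_upwards [hns, hall] with x hx hx'
    refine le_of_tendsto hx.abs (Eventually.of_forall fun n => ?_)
    rw [hx']
    exact hdR _ x
  have tf : Tendsto (fun n => hf'L.compLp hf'0 (re ((w n).toLp 2 volume))) atTop (𝓝 g) := by
    have e : hf'L.compLp hf'0 φ = g := by
      refine Lp.ext ?_
      filter_upwards [hf'L.coeFn_compLp hf'0 φ, hg, hφR] with x h1 h2 h3
      rw [h1, h2, Function.comp_apply, hf' (abs_le.1 h3)]
    rw [← e]
    exact ((hf'L.continuous_compLp hf'0).tendsto _).comp tφ
  have hfn : ∀ n, hf'L.compLp hf'0 (re ((w n).toLp 2 volume)) =ᵐ[volume] fun x => f (d n x) :=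
    fun n => by
    filter_upwards [hf'L.coeFn_compLp hf'0 (re ((w n).toLp 2 volume)), hdn n] with x h1 h2
    rw [h1, Function.comp_apply, h2, hf' (abs_le.1 (hdR n x))]
  have hsin : MemLp (fun x => Real.sin (ω * x)) ⊤ volume :=
    memLp_top_of_bound (Continuous.aestronglyMeasurable (by fun_prop)) 1
      (Eventually.of_forall fun x => Real.abs_sin_le_one _)
  have hcos : MemLp (fun x => Real.cos (ω * x)) ⊤ volume :=
    memLp_top_of_bound (Continuous.aestronglyMeasurable (by fun_prop)) 1
      (Eventually.of_forall fun x => Real.abs_cos_le_one _)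
  have l1 := tendsto_integral_mul_mul hsin tf tD
  have l2 := ((tendsto_integral_mul_mul hcos tφ tf).const_mul κ).const_mul (-ω)
  have heq : ∀ n, ∫ x, Real.sin (ω * x) * hf'L.compLp hf'0 (re ((w n).toLp 2 volume)) x *
      re ((SchwartzMap.derivCLM ℂ ℂ (w n)).toLp 2 volume) x =
      -ω * (κ * ∫ x, Real.cos (ω * x) * re ((w n).toLp 2 volume) x *
        hf'L.compLp hf'0 (re ((w n).toLp 2 volume)) x) := by
    intro n
    have h := integral_sin_mul_comp_mul_deriv_schwartz (f := f) (F := fun s => κ * (s * f s))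
      (L := max (K : ℝ) (|κ| * R * K)) (R := R) hf.continuous (le_max_of_le_left K.2) hF
      (fun s hs => (hfK s hs).trans (mul_le_mul_of_nonneg_right (le_max_left _ _) (abs_nonneg _)))
      (fun s hs => (hFK s hs).trans (mul_le_mul_of_nonneg_right (le_max_right _ _) (abs_nonneg _)))
      (d n) (hdR n) ω
    have e1 : ∫ x, Real.sin (ω * x) * hf'L.compLp hf'0 (re ((w n).toLp 2 volume)) x *
        re ((SchwartzMap.derivCLM ℂ ℂ (w n)).toLp 2 volume) x =
        ∫ x, Real.sin (ω * x) * f (d n x) * deriv (d n) x := by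
      refine integral_congr_ae ?_
      filter_upwards [hfn n, hdn' n] with x h1 h2
      rw [h1, h2]
    rw [e1, h, ← integral_const_mul κ]
    congr 1
    refine integral_congr_ae ?_
    filter_upwards [hfn n, hdn n] with x h1 h2
    rw [h1, h2]
    ring
  have := tendsto_nhds_unique l1 (l2.congr fun n => (heq n).symm)
  rw [← this]
  refine integral_congr_ae ?_
  filter_upwards [hre D] with x hx
  rw [hx]

/-! ### Translations in frequency and the commutator estimate. -/

/-- Translation on `L²(ℝ; ℂ)`. -/
def translate (ε : ℝ) (h : Lp ℂ 2 (volume : Measure ℝ)) : Lp ℂ 2 (volume : Measure ℝ) :=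
  DomAddAct.mk (-ε) +ᵥ h

theorem coe_translate (ε : ℝ) (h : Lp ℂ 2 (volume : Measure ℝ)) :
    translate ε h =ᵐ[volume] fun x => h (x - ε) := by
  filter_upwards [DomAddAct.vadd_Lp_ae_eq (DomAddAct.mk (-ε)) h] with x hx
  rw [translate, hx, Equiv.symm_apply_apply, vadd_eq_add, sub_eq_neg_add]

theorem norm_translate (ε : ℝ) (h : Lp ℂ 2 (volume : Measure ℝ)) : ‖translate ε h‖ = ‖h‖ :=
  DomAddAct.norm_vadd_Lp _ _

theorem tendsto_translate (h : Lp ℂ 2 (volume : Measure ℝ)) :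
    Tendsto (fun ε : ℝ => translate ε h) (𝓝 0) (𝓝 h) := by
  have : Fact ((2 : ℝ≥0∞) ≠ ∞) := ⟨ENNReal.ofNat_ne_top⟩
  have hc : Continuous fun ε : ℝ => translate ε h :=
    (DomAddAct.continuous_mk.comp continuous_neg).vadd continuous_const
  have := hc.tendsto 0
  have e : translate 0 h = h := by rw [translate, neg_zero, DomAddAct.mk_zero, zero_vadd]
  rwa [e] at this

theorem ae_sub_right {P : ℝ → Prop} (h : ∀ᵐ x, P x) (ε : ℝ) : ∀ᵐ x, P (x - ε) :=
  (measurePreserving_sub_right volume ε).quasiMeasurePreserving.ae h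

theorem integrable_re_mul_add_im_mul (u v : Lp ℂ 2 (volume : Measure ℝ)) :
    Integrable fun x => (u x).re * (v x).re + (u x).im * (v x).im := by
  refine (L2.integrable_inner (𝕜 := ℂ) u v).re.congr (Eventually.of_forall fun x => ?_)
  simp [RCLike.inner_apply]
  ring

theorem re_inner_eq_integral (u v : Lp ℂ 2 (volume : Measure ℝ)) :
    (inner ℂ u v).re = ∫ x, ((u x).re * (v x).re + (u x).im * (v x).im) := by
  rw [L2.inner_def]
  refine (integral_re (L2.integrable_inner (𝕜 := ℂ) u v)).symm.trans ?_
  refine integral_congr_ae (Eventually.of_forall fun x => ?_)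
  simp [RCLike.inner_apply]
  ring

theorem inner_translate_neg (ε : ℝ) (u v : Lp ℂ 2 (volume : Measure ℝ)) :
    inner ℂ u (translate (-ε) v) = inner ℂ (translate ε u) v := by
  rw [L2.inner_def, L2.inner_def]
  have h1 : ∫ x, inner ℂ (u x) (translate (-ε) v x) = ∫ x, inner ℂ (u x) (v (x + ε)) := by
    refine integral_congr_ae ?_
    filter_upwards [coe_translate (-ε) v] with x hx
    rw [hx, sub_neg_eq_add]
  have h2 : ∫ x, inner ℂ (translate ε u x) (v x) = ∫ x, inner ℂ (u (x - ε)) (v x) := by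
    refine integral_congr_ae ?_
    filter_upwards [coe_translate ε u] with x hx
    rw [hx]
  rw [h1, h2, ← integral_sub_right_eq_self (fun x => inner ℂ (u x) (v (x + ε))) ε]
  simp only [sub_add_cancel]

/-- The difference vanishes unless `x` and `x - ε` lie on opposite sides of the origin, and then
both have modulus at most `|ε|`. This second-order smallness is why the dispersive term disappears
from the Pohozaev identity. -/
theorem abs_mul_sub_abs_mul_le (x ε : ℝ) : abs (|x| * (x - ε) - |x - ε| * x) ≤ ε ^ 2 := by
  rcases le_total 0 x with hx | hx <;> rcases le_total 0 (x - ε) with hy | hy <;>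
    simp only [abs_of_nonneg, abs_of_nonpos, hx, hy] <;> rw [abs_le] <;>
    constructor <;> nlinarith [mul_self_nonneg x, sq_nonneg ε, sq_nonneg (x - ε),
      sq_nonneg (2 * x - ε)]

/-- The commutator of the Fourier multiplier `β|ξ| - c + γ/ξ²` with the symmetrised translate of
multiplication by `ξ`, up to an error of second order in the translation. -/
theorem abs_commutator_le {a b v u₁ u₂ : Lp ℂ 2 (volume : Measure ℝ)} {β c γ : ℝ}
    (hb : b =ᵐ[volume] fun ξ : ℝ => ((-(β * |ξ| - c + γ * (ξ ^ 2)⁻¹) : ℝ) : ℂ) * a ξ)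
    (hv : v =ᵐ[volume] fun ξ : ℝ => (ξ : ℂ) * a ξ)
    (hu₁ : u₁ =ᵐ[volume] fun ξ : ℝ => ((ξ⁻¹ : ℝ) : ℂ) * a ξ)
    (hu₂ : u₂ =ᵐ[volume] fun ξ : ℝ => (((ξ ^ 2)⁻¹ : ℝ) : ℂ) * a ξ) (ε : ℝ) :
    |(inner ℂ (translate ε b) v).re - (inner ℂ b (translate ε v)).re
        - c * ε * (inner ℂ a (translate ε a)).re + 3 * γ * ε * (inner ℂ u₁ (translate ε u₁)).re
        + γ * ε ^ 3 * (inner ℂ u₂ (translate ε u₂)).re| ≤ |β| * ε ^ 2 * (2 * ‖a‖ ^ 2) := by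
  have i1 := integrable_re_mul_add_im_mul (translate ε b) v
  have i2 := integrable_re_mul_add_im_mul b (translate ε v)
  have i3 := (integrable_re_mul_add_im_mul a (translate ε a)).const_mul (c * ε)
  have i4 := (integrable_re_mul_add_im_mul u₁ (translate ε u₁)).const_mul (3 * γ * ε)
  have i5 := (integrable_re_mul_add_im_mul u₂ (translate ε u₂)).const_mul (γ * ε ^ 3)
  simp only [re_inner_eq_integral]
  have comb : ∀ {F₁ F₂ F₃ F₄ F₅ : ℝ → ℝ}, Integrable F₁ → Integrable F₂ → Integrable F₃ →
      Integrable F₄ → Integrable F₅ → (∫ x, F₁ x) - (∫ x, F₂ x) - (∫ x, F₃ x) + (∫ x, F₄ x) +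
      (∫ x, F₅ x) = ∫ x, (F₁ x - F₂ x - F₃ x + F₄ x + F₅ x) := by
    intro F₁ F₂ F₃ F₄ F₅ h1 h2 h3 h4 h5
    have h12 : Integrable fun x => F₁ x - F₂ x := h1.sub h2
    have h13 : Integrable fun x => F₁ x - F₂ x - F₃ x := h12.sub h3
    have h14 : Integrable fun x => F₁ x - F₂ x - F₃ x + F₄ x := h13.add h4
    rw [integral_add h14 h5, integral_add h13 h4, integral_sub h12 h3, integral_sub h1 h2]
  rw [← integral_const_mul, ← integral_const_mul, ← integral_const_mul, comb i1 i2 i3 i4 i5]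
  have j1 := integrable_norm_sq_Lp a
  have j2 := integrable_norm_sq_Lp (translate ε a)
  have hn : |β| * ε ^ 2 * (2 * ‖a‖ ^ 2) =
      ∫ ξ, |β| * ε ^ 2 * (‖a ξ‖ ^ 2 + ‖translate ε a ξ‖ ^ 2) := by
    rw [integral_const_mul, integral_add j1 j2, integral_norm_sq_eq, integral_norm_sq_eq,
      norm_translate]
    ring
  rw [hn]
  refine (Real.norm_eq_abs _).symm.trans_le
    (norm_integral_le_of_norm_le ((j1.add j2).const_mul _) ?_)
  have h0 : ∀ᵐ ξ : ℝ, ξ ≠ 0 := by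
    rw [ae_iff]; simp
  filter_upwards [hb, ae_sub_right hb ε, hv, ae_sub_right hv ε, hu₁, ae_sub_right hu₁ ε, hu₂,
    ae_sub_right hu₂ ε, coe_translate ε a, coe_translate ε b, coe_translate ε v,
    coe_translate ε u₁, coe_translate ε u₂, h0, ae_sub_right h0 ε] with ξ e1 e2 e3 e4 e5 e6 e7 e8
    e9 e10 e11 e12 e13 hξ hη
  rw [e9, e10, e11, e12, e13, e1, e2, e3, e4, e5, e6, e7, e8]
  simp only [Complex.re_ofReal_mul, Complex.im_ofReal_mul]
  have hsub : ε = ξ - (ξ - ε) := by ring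
  generalize a ξ = A at *
  generalize a (ξ - ε) = B at *
  -- With `η = ξ - ε`, the constant in the symbol contributes `c(ξ - η) = cε`. The singular part
  -- contributes `-γ(ξ³ - η³)/(ξη)²` with `ξ³ - η³ = 3εξη + ε³`: hence the coefficient 3 and the
  -- `ε³` correction. Only the `|ξ|` part is left as an error.
  have key : -(β * |ξ - ε| - c + γ * ((ξ - ε) ^ 2)⁻¹) * B.re * (ξ * A.re) +
        -(β * |ξ - ε| - c + γ * ((ξ - ε) ^ 2)⁻¹) * B.im * (ξ * A.im) -
        (-(β * |ξ| - c + γ * (ξ ^ 2)⁻¹) * A.re * ((ξ - ε) * B.re) +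
          -(β * |ξ| - c + γ * (ξ ^ 2)⁻¹) * A.im * ((ξ - ε) * B.im)) -
        c * ε * (A.re * B.re + A.im * B.im) +
        3 * γ * ε * (ξ⁻¹ * A.re * ((ξ - ε)⁻¹ * B.re) + ξ⁻¹ * A.im * ((ξ - ε)⁻¹ * B.im)) +
        γ * ε ^ 3 * ((ξ ^ 2)⁻¹ * A.re * (((ξ - ε) ^ 2)⁻¹ * B.re) +
          (ξ ^ 2)⁻¹ * A.im * (((ξ - ε) ^ 2)⁻¹ * B.im)) =
      β * (|ξ| * (ξ - ε) - |ξ - ε| * ξ) * (A.re * B.re + A.im * B.im) := by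
    generalize |ξ| = s
    generalize |ξ - ε| = t
    field_simp
    ring
  have hk := abs_mul_sub_abs_mul_le ξ ε
  have hr : |A.re * B.re + A.im * B.im| ≤ ‖A‖ ^ 2 + ‖B‖ ^ 2 := by
    rw [Complex.sq_norm, Complex.sq_norm, Complex.normSq_apply, Complex.normSq_apply, abs_le]
    constructor <;> nlinarith [sq_nonneg (A.re - B.re), sq_nonneg (A.im - B.im),
      sq_nonneg (A.re + B.re), sq_nonneg (A.im + B.im)]
  rw [key, Real.norm_eq_abs, abs_mul, abs_mul]
  exact mul_le_mul (mul_le_mul_of_nonneg_left hk (abs_nonneg _)) hr (abs_nonneg _) (by positivity)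

/-- The Fourier transform of `sin(2πεx) D / π` is a symmetric difference of translates. -/
theorem re_inner_translate_sub {g : L2R} {D v : Lp ℂ 2 (volume : Measure ℝ)}
    (hD : (𝓕 D : Lp ℂ 2 (volume : Measure ℝ)) =ᵐ[volume] fun ξ : ℝ =>
      2 * Real.pi * Complex.I * v ξ) (ε : ℝ) :
    (inner ℂ (𝓕 (toComplex g)) (translate ε v)).re - (inner ℂ (translate ε (𝓕 (toComplex g))) v).re
      = Real.pi⁻¹ * ∫ x, Real.sin (2 * Real.pi * ε * x) * g x * (D x).re := by
  have hm : ∀ ε : ℝ, MemLp (fun x : ℝ => Complex.exp (2 * Real.pi * ε * x * Complex.I) * D x) 2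
      volume := fun ε => by
    refine (Lp.memLp D).of_le_mul (c := 1) ((Continuous.aestronglyMeasurable (by fun_prop)).mul
      (Lp.aestronglyMeasurable D)) (Eventually.of_forall fun x => ?_)
    have : Complex.exp (2 * Real.pi * ε * x * Complex.I) =
        Complex.exp ((2 * Real.pi * ε * x : ℝ) * Complex.I) := by push_cast; rfl
    rw [norm_mul, this, Complex.norm_exp_ofReal_mul_I]
  set k : ℝ → Lp ℂ 2 (volume : Measure ℝ) := fun ε => (hm ε).toLp _
  have hk : ∀ ε, k ε =ᵐ[volume] fun x => Complex.exp (2 * Real.pi * ε * x * Complex.I) * D x :=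
    fun ε => (hm ε).coeFn_toLp
  -- Modulation by `e^{2πiεx}` translates `𝓕 D` by `ε`; subtracting the modulation by `-ε` produces
  -- `2i sin(2πεx)`.
  have hF : ∀ ε, 𝓕 (k ε) = (2 * Real.pi * Complex.I : ℂ) • translate ε v := fun ε => by
    refine Lp.ext ?_
    filter_upwards [fourier_modulation_ae_eq ε D (k ε) (hk ε), ae_sub_right hD ε,
      coe_translate ε v, Lp.coeFn_smul (2 * Real.pi * Complex.I : ℂ) (translate ε v)]
      with ξ h1 h2 h3 h4
    rw [h1, h2, h4, Pi.smul_apply, h3, smul_eq_mul]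
  have hi : ∀ ε, (2 * Real.pi * Complex.I : ℂ) * inner ℂ (𝓕 (toComplex g)) (translate ε v) =
      inner ℂ (toComplex g) (k ε) := fun ε => by
    rw [← Lp.inner_fourier_eq (toComplex g) (k ε), hF, inner_smul_right]
  have hd : (2 * Real.pi * Complex.I : ℂ) * (inner ℂ (𝓕 (toComplex g)) (translate ε v) -
      inner ℂ (translate ε (𝓕 (toComplex g))) v) = inner ℂ (toComplex g) (k ε - k (-ε)) := by
    rw [← inner_translate_neg, mul_sub, hi, hi, inner_sub_right]
  have hint : inner ℂ (toComplex g) (k ε - k (-ε)) =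
      (2 * Complex.I) * ∫ x, ((Real.sin (2 * Real.pi * ε * x) * g x : ℝ) : ℂ) * D x := by
    rw [L2.inner_def, ← integral_const_mul]
    refine integral_congr_ae ?_
    filter_upwards [coe_toComplex g, hk ε, hk (-ε), Lp.coeFn_sub (k ε) (k (-ε))] with x h1 h2 h3 h4
    rw [h1, h4, Pi.sub_apply, h2, h3, RCLike.inner_apply, Complex.conj_ofReal, ← sub_mul,
      Complex.ofReal_mul, Complex.ofReal_sin, Complex.sin]
    push_cast
    have hI := Complex.I_mul_I
    rw [show (2 * Real.pi * -ε * x * Complex.I : ℂ) = -(2 * Real.pi * ε * x) * Complex.I by ring]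
    linear_combination (-(Complex.exp (-(2 * Real.pi * ε * x) * Complex.I) -
      Complex.exp (2 * Real.pi * ε * x * Complex.I)) * (g x : ℂ) * D x) * hI
  have hsg : Integrable fun x => ((Real.sin (2 * Real.pi * ε * x) * g x : ℝ) : ℂ) * D x := by
    have h1 : MemLp (fun x => ((Real.sin (2 * Real.pi * ε * x) * g x : ℝ) : ℂ)) 2 volume := by
      refine (Lp.memLp g).of_le_mul (c := 1) (Complex.continuous_ofReal.comp_aestronglyMeasurable
        ((Continuous.aestronglyMeasurable (by fun_prop)).mul (Lp.aestronglyMeasurable g)))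
        (Eventually.of_forall fun x => ?_)
      rw [Complex.norm_real, norm_mul]
      exact mul_le_mul_of_nonneg_right (Real.abs_sin_le_one _) (norm_nonneg _)
    exact h1.integrable_mul (Lp.memLp D)
  rw [hint] at hd
  have hd' : inner ℂ (𝓕 (toComplex g)) (translate ε v) -
      inner ℂ (translate ε (𝓕 (toComplex g))) v =
      ((Real.pi⁻¹ : ℝ) : ℂ) * ∫ x, ((Real.sin (2 * Real.pi * ε * x) * g x : ℝ) : ℂ) * D x := by
    have hpi : (Real.pi : ℂ) ≠ 0 := Complex.ofReal_ne_zero.2 Real.pi_ne_zero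
    refine mul_left_cancel₀ (a := (2 * Real.pi * Complex.I : ℂ))
      (mul_ne_zero (mul_ne_zero two_ne_zero hpi) Complex.I_ne_zero) (hd.trans ?_)
    rw [Complex.ofReal_inv, ← mul_assoc]
    congr 1
    field_simp
  have hre := congrArg Complex.re hd'
  rw [Complex.sub_re, Complex.re_ofReal_mul] at hre
  rw [hre]
  congr 1
  refine (integral_re hsg).symm.trans ?_
  refine integral_congr_ae (Eventually.of_forall fun x => ?_)
  exact Complex.re_ofReal_mul _ _

/-! ### Extra decay of the Fourier transform and the Pohozaev identity. -/

/-- The equation for the Fourier transform forces additional decay at infinity and at the origin. -/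
theorem memLp_mul_and_memLp_div_of_equation {a b : Lp ℂ 2 (volume : Measure ℝ)} {β c γ : ℝ}
    (hβ : β ≠ 0) (hγ : γ ≠ 0)
    (hb : b =ᵐ[volume] fun ξ : ℝ => ((-(β * |ξ| - c + γ * (ξ ^ 2)⁻¹) : ℝ) : ℂ) * a ξ) :
    MemLp (fun ξ : ℝ => (ξ : ℂ) * a ξ) 2 volume ∧
      MemLp (fun ξ : ℝ => (((ξ ^ 2)⁻¹ : ℝ) : ℂ) * a ξ) 2 volume := by
  have hb' : ∀ᵐ ξ : ℝ, ‖b ξ‖ = abs (β * |ξ| - c + γ * (ξ ^ 2)⁻¹) * ‖a ξ‖ := by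
    filter_upwards [hb] with ξ h
    rw [h, norm_mul, Complex.norm_real, norm_neg, Real.norm_eq_abs]
  have hs : MemLp (fun ξ => ‖a ξ‖ + ‖b ξ‖) 2 volume := (Lp.memLp a).norm.add (Lp.memLp b).norm
  have hβ' := abs_pos.2 hβ
  have hγ' := abs_pos.2 hγ
  have h1 : MemLp (fun ξ : ℝ => (ξ : ℂ) * a ξ) 2 volume := by
    refine hs.of_le_mul (c := 1 + (|c| + |γ| + 1) / |β|)
      ((Continuous.aestronglyMeasurable (by fun_prop)).mul (Lp.aestronglyMeasurable a)) ?_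
    filter_upwards [hb'] with ξ h
    have ha := norm_nonneg (a ξ)
    have hn := norm_nonneg (b ξ)
    have hq : 0 ≤ (|c| + |γ| + 1) / |β| := by positivity
    rw [norm_mul, Complex.norm_real, Real.norm_eq_abs, Real.norm_of_nonneg (by positivity)]
    rcases le_total |ξ| 1 with hξ | hξ
    · nlinarith [mul_le_mul_of_nonneg_right hξ ha, mul_nonneg hq (add_nonneg ha hn)]
    -- For `|ξ| ≥ 1` the singular term is bounded by `|γ|`, so `β|ξ|a` is controlled by `a` and `b`.
    -- Once `ξa ∈ L²` is known, the equation can be solved for `γξ⁻²a` in the same way.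
    · have hi : |γ * (ξ ^ 2)⁻¹| ≤ |γ| := by
        rw [abs_mul, abs_inv, abs_pow]
        exact mul_le_of_le_one_right hγ'.le (inv_le_one_of_one_le₀ (one_le_pow₀ hξ))
      have h2 : |β| * |ξ| ≤ abs (β * |ξ| - c + γ * (ξ ^ 2)⁻¹) + |c| + |γ| := by
        calc |β| * |ξ| = abs ((β * |ξ| - c + γ * (ξ ^ 2)⁻¹) + c - γ * (ξ ^ 2)⁻¹) := by
              rw [show (β * |ξ| - c + γ * (ξ ^ 2)⁻¹) + c - γ * (ξ ^ 2)⁻¹ = β * |ξ| by ring,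
                abs_mul, abs_abs]
          _ ≤ abs ((β * |ξ| - c + γ * (ξ ^ 2)⁻¹) + c) + |γ * (ξ ^ 2)⁻¹| := abs_sub _ _
          _ ≤ _ := add_le_add (abs_add_le _ _) hi
      have h3 := mul_le_mul_of_nonneg_right h2 ha
      have h4 : |β| * (|ξ| * ‖a ξ‖) ≤ |β| * ((|c| + |γ| + 1) / |β| * (‖a ξ‖ + ‖b ξ‖)) := by
        rw [← mul_assoc |β| (_ / _), mul_div_cancel₀ _ hβ'.ne']
        nlinarith [mul_nonneg (abs_nonneg c) hn, mul_nonneg (abs_nonneg γ) hn]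
      have h5 := le_of_mul_le_mul_left h4 hβ'
      nlinarith
  refine ⟨h1, ?_⟩
  have hs' : MemLp (fun ξ : ℝ => ‖(ξ : ℂ) * a ξ‖ + (‖a ξ‖ + ‖b ξ‖)) 2 volume := h1.norm.add hs
  refine hs'.of_le_mul (c := (|β| + |c| + 1) / |γ|) ((Measurable.aestronglyMeasurable
    (by fun_prop)).mul (Lp.aestronglyMeasurable a)) ?_
  filter_upwards [hb'] with ξ h
  have ha := norm_nonneg (a ξ)
  have hn := norm_nonneg (b ξ)
  rw [Real.norm_of_nonneg (r := _ + _) (by positivity), norm_mul, norm_mul, Complex.norm_real,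
    Complex.norm_real, Real.norm_eq_abs, Real.norm_eq_abs]
  have h2 : |γ| * |(ξ ^ 2)⁻¹| ≤ abs (β * |ξ| - c + γ * (ξ ^ 2)⁻¹) + |c| + |β| * |ξ| := by
    calc |γ| * |(ξ ^ 2)⁻¹| = abs ((β * |ξ| - c + γ * (ξ ^ 2)⁻¹) + c - β * |ξ|) := by
          rw [← abs_mul]; congr 1; ring
      _ ≤ abs ((β * |ξ| - c + γ * (ξ ^ 2)⁻¹) + c) + abs (β * |ξ|) := abs_sub _ _
      _ ≤ _ := add_le_add (abs_add_le _ _) (by rw [abs_mul, abs_abs])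
  have h3 := mul_le_mul_of_nonneg_right h2 ha
  refine le_of_mul_le_mul_left ?_ hγ'
  rw [← mul_assoc |γ| (_ / _), mul_div_cancel₀ _ hγ'.ne']
  have h6 : 0 ≤ |ξ| * ‖a ξ‖ := by positivity
  nlinarith [mul_nonneg (abs_nonneg c) hn, mul_nonneg (abs_nonneg β) hn,
    mul_nonneg (abs_nonneg β) ha, mul_nonneg (abs_nonneg c) h6]

/-- The Pohozaev identity. -/
theorem pohozaev_identity {f : ℝ → ℝ} {κ : ℝ} (hf : ContDiff ℝ 1 f) (hf0 : f 0 = 0)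
    (hF : ∀ s, HasDerivAt (fun s => κ * (s * f s)) (f s) s) {φ g : L2R}
    (hg : g =ᵐ[volume] fun x => f (φ x)) {β c γ : ℝ} (hβ : β ≠ 0) (hγ : γ ≠ 0)
    (hb : (𝓕 (toComplex g) : Lp ℂ 2 (volume : Measure ℝ)) =ᵐ[volume] fun ξ : ℝ =>
      ((-(β * |ξ| - c + γ * (ξ ^ 2)⁻¹) : ℝ) : ℂ) *
        (𝓕 (toComplex φ) : Lp ℂ 2 (volume : Measure ℝ)) ξ)
    {u : Lp ℂ 2 (volume : Measure ℝ)} (hu : u =ᵐ[volume] fun ξ : ℝ => ((ξ⁻¹ : ℝ) : ℂ) *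
        (𝓕 (toComplex φ) : Lp ℂ 2 (volume : Measure ℝ)) ξ) :
    2 * κ * ∫ x, φ x * g x =
      c * ‖(𝓕 (toComplex φ) : Lp ℂ 2 (volume : Measure ℝ))‖ ^ 2 - 3 * γ * ‖u‖ ^ 2 := by
  set a : Lp ℂ 2 (volume : Measure ℝ) := 𝓕 (toComplex φ)
  obtain ⟨hv, hw⟩ := memLp_mul_and_memLp_div_of_equation hβ hγ hb
  set v := hv.toLp _
  set w := hw.toLp _
  set D : Lp ℂ 2 (volume : Measure ℝ) := 𝓕⁻ ((2 * Real.pi * Complex.I : ℂ) • v)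
  have hD : (𝓕 D : Lp ℂ 2 (volume : Measure ℝ)) =ᵐ[volume] fun ξ : ℝ =>
      2 * Real.pi * Complex.I * v ξ := by
    rw [FourierTransform.fourier_fourierInv_eq]
    exact Lp.coeFn_smul _ _
  have hD' : (𝓕 D : Lp ℂ 2 (volume : Measure ℝ)) =ᵐ[volume] fun ξ : ℝ =>
      2 * Real.pi * Complex.I * ξ * a ξ := by
    filter_upwards [hD, hv.coeFn_toLp] with ξ h1 h2
    rw [h1, h2, mul_assoc _ (ξ : ℂ)]
  have hφg : Integrable fun x => φ x * g x := (Lp.memLp φ).integrable_mul (Lp.memLp g)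
  -- The commutator estimate after division by `ε`, with the nonlinear term integrated by parts. As
  -- `ε → 0` the cosine tends to 1, the translates converge in `L²`, and the right side vanishes.
  have hbound : ∀ ε : ℝ, 0 < ε → ‖2 * κ * (∫ x, Real.cos (2 * Real.pi * ε * x) * φ x * g x) -
      c * (inner ℂ a (translate ε a)).re + 3 * γ * (inner ℂ u (translate ε u)).re +
      γ * ε ^ 2 * (inner ℂ w (translate ε w)).re‖ ≤ ε * (|β| * (2 * ‖a‖ ^ 2)) := by
    intro ε hε
    have h1 := abs_commutator_le hb hv.coeFn_toLp hu hw.coeFn_toLp ε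
    have h2 := re_inner_translate_sub (g := g) hD ε
    rw [integral_sin_mul_comp_mul_deriv hf hf0 hF hg hD'] at h2
    have h3 : Real.pi⁻¹ * (-(2 * Real.pi * ε) *
        (κ * ∫ x, Real.cos (2 * Real.pi * ε * x) * φ x * g x)) =
        -(2 * ε * (κ * ∫ x, Real.cos (2 * Real.pi * ε * x) * φ x * g x)) := by
      field_simp
    rw [h3] at h2
    rw [Real.norm_eq_abs]
    refine le_of_mul_le_mul_left ?_ hε
    nth_rewrite 1 [← abs_of_pos hε]
    rw [← abs_mul]
    refine Eq.trans_le (congrArg abs ?_) (h1.trans_eq (by ring))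
    linear_combination h2
  have hcos : Tendsto (fun ε : ℝ => ∫ x, Real.cos (2 * Real.pi * ε * x) * φ x * g x) (𝓝[>] 0)
      (𝓝 (∫ x, φ x * g x)) := by
    refine tendsto_integral_filter_of_dominated_convergence (fun x => ‖φ x * g x‖)
      (Eventually.of_forall fun ε => ?_) (Eventually.of_forall fun ε =>
      Eventually.of_forall fun x => ?_) hφg.norm (Eventually.of_forall fun x => ?_)
    · simp_rw [mul_assoc _ (φ _)]
      exact (Continuous.aestronglyMeasurable (by fun_prop)).mul hφg.1
    · rw [mul_assoc _ (φ x), norm_mul]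
      exact mul_le_of_le_one_left (norm_nonneg _) (Real.abs_cos_le_one _)
    · have hc : Continuous fun ε : ℝ => Real.cos (2 * Real.pi * ε * x) * φ x * g x := by fun_prop
      have := (hc.tendsto 0).mono_left (nhdsWithin_le_nhds (s := Set.Ioi 0))
      simpa using this
  have hin : ∀ z : Lp ℂ 2 (volume : Measure ℝ),
      Tendsto (fun ε : ℝ => (inner ℂ z (translate ε z)).re) (𝓝[>] 0) (𝓝 (‖z‖ ^ 2)) := by
    intro z
    have h := ((Complex.continuous_re.comp ((innerSL ℂ z).continuous)).tendsto z).comp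
      ((tendsto_translate z).mono_left (nhdsWithin_le_nhds (s := Set.Ioi 0)))
    have e : ‖z‖ ^ 2 = (inner ℂ z z).re := (inner_self_eq_norm_sq (𝕜 := ℂ) z).symm
    rw [e]
    exact h
  have hε : Tendsto (fun ε : ℝ => ε) (𝓝[>] 0) (𝓝 0) := nhdsWithin_le_nhds
  have hlim := (((hcos.const_mul (2 * κ)).sub ((hin a).const_mul c)).add
    ((hin u).const_mul (3 * γ))).add (((hε.pow 2).const_mul γ).mul (hin w))
  have hzero := squeeze_zero_norm' (eventually_nhdsWithin_of_forall (s := Set.Ioi (0 : ℝ)) (a := 0)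
    fun ε hε => hbound ε hε)
    (by simpa using hε.mul_const (|β| * (2 * ‖a‖ ^ 2)))
  have := tendsto_nhds_unique hlim hzero
  linear_combination this

/-! ### Energy identity, positive weights and the vanishing of solutions. -/

/-- AM-GM for `As/2`, `As/2`, `B/s²`, whose product `A²B/4` does not depend on `s`. With `x = As/2`
and `y = B/s²` it is the identity `(2x+y)³ - 27x²y = (y-x)²(8x+y)`. -/
theorem lt_mul_add_div_sq {A B k s : ℝ} (hA : 0 < A) (hB : 0 < B) (hs : 0 < s)
    (hk : k ^ 3 < 27 * (A ^ 2 * B) / 4) : k < A * s + B * (s ^ 2)⁻¹ := by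
  refine lt_of_pow_lt_pow_left₀ 3 (by positivity) (hk.trans_le ?_)
  have e : 27 * (A ^ 2 * B) / 4 = 27 * (A * s / 2) ^ 2 * (B * (s ^ 2)⁻¹) := by
    field_simp
    ring
  rw [e, show A * s + B * (s ^ 2)⁻¹ = 2 * (A * s / 2) + B * (s ^ 2)⁻¹ by ring]
  have hx : 0 < A * s / 2 := by positivity
  have hy : 0 < B * (s ^ 2)⁻¹ := by positivity
  generalize A * s / 2 = x at *
  generalize B * (s ^ 2)⁻¹ = y at *
  nlinarith [mul_nonneg (sq_nonneg (y - x)) (show 0 ≤ 8 * x + y by positivity)]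

/-- The energy identity. -/
theorem energy_identity {φ g : L2R} {β c γ : ℝ}
    (hb : (𝓕 (toComplex g) : Lp ℂ 2 (volume : Measure ℝ)) =ᵐ[volume] fun ξ : ℝ =>
      ((-(β * |ξ| - c + γ * (ξ ^ 2)⁻¹) : ℝ) : ℂ) *
        (𝓕 (toComplex φ) : Lp ℂ 2 (volume : Measure ℝ)) ξ) :
    ∫ x, φ x * g x = -∫ ξ : ℝ, (β * |ξ| - c + γ * (ξ ^ 2)⁻¹) *
      ‖(𝓕 (toComplex φ) : Lp ℂ 2 (volume : Measure ℝ)) ξ‖ ^ 2 := by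
  have h := congrArg Complex.re (Lp.inner_fourier_eq (toComplex φ) (toComplex g))
  rw [re_inner_eq_integral, re_inner_eq_integral] at h
  have h1 : ∫ x, φ x * g x = ∫ x, ((toComplex φ x).re * (toComplex g x).re +
      (toComplex φ x).im * (toComplex g x).im) := by
    refine integral_congr_ae ?_
    filter_upwards [coe_toComplex φ, coe_toComplex g] with x h1 h2
    rw [h1, h2]
    simp
  rw [h1, ← h, ← integral_neg]
  refine integral_congr_ae ?_
  filter_upwards [hb] with ξ h
  rw [h, Complex.re_ofReal_mul, Complex.im_ofReal_mul, Complex.sq_norm, Complex.normSq_apply]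
  ring

theorem eq_zero_of_fourier_ae_eq_zero {φ : L2R}
    (h : ∀ᵐ ξ : ℝ, (𝓕 (toComplex φ) : Lp ℂ 2 (volume : Measure ℝ)) ξ = 0) : φ = 0 := by
  have h0 : (𝓕 (toComplex φ) : Lp ℂ 2 (volume : Measure ℝ)) = 0 := by
    refine Lp.ext ?_
    filter_upwards [h, Lp.coeFn_zero ℂ 2 (volume : Measure ℝ)] with ξ h1 h2
    rw [h1, h2, Pi.zero_apply]
  have hz : toComplex φ = 0 := by
    rw [← norm_eq_zero, ← Lp.norm_fourier_eq, h0, norm_zero]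
  refine Lp.ext ?_
  filter_upwards [coe_toComplex φ, Lp.coeFn_zero ℝ 2 (volume : Measure ℝ),
    Lp.coeFn_zero ℂ 2 (volume : Measure ℝ)] with x h1 h2 h3
  rw [hz, h3, Pi.zero_apply] at h1
  rw [h2, Pi.zero_apply]
  exact (Complex.ofReal_eq_zero.1 h1.symm)

/-- A weight of one sign with vanishing integral against `|a|²` forces `a = 0`. -/
theorem ae_eq_zero_of_integral_mul_norm_sq_eq_zero {a : ℝ → ℂ} {m : ℝ → ℝ}
    (hm : ∀ ξ, ξ ≠ 0 → 0 < m ξ) (hi : Integrable fun ξ => m ξ * ‖a ξ‖ ^ 2)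
    (h : ∫ ξ, m ξ * ‖a ξ‖ ^ 2 = 0) : ∀ᵐ ξ : ℝ, a ξ = 0 := by
  have h0 : ∀ᵐ ξ : ℝ, ξ ≠ 0 := by
    rw [ae_iff]; simp
  have hnn : 0 ≤ᵐ[volume] fun ξ => m ξ * ‖a ξ‖ ^ 2 := by
    filter_upwards [h0] with ξ hξ
    exact mul_nonneg (hm ξ hξ).le (sq_nonneg _)
  filter_upwards [(integral_eq_zero_iff_of_nonneg_ae hnn hi).1 h, h0] with ξ h1 hξ
  simpa [(hm ξ hξ).ne'] using h1

/-- The consequences of the equation: the nonlinear term is square integrable, the Fourier side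
carries the weights `|ξ|`, `1` and `ξ⁻²`, and the energy and Pohozaev identities hold. -/
theorem IsSolution.identities {p β c γ : ℝ} (hp : 1 < p) {f : ℝ → ℝ} (hf : ContDiff ℝ 1 f)
    (hom : ∀ s : ℝ, s * deriv f s = p * f s) (hβ : β ≠ 0) (hγ : γ ≠ 0) {φ : L2R}
    {hφ : φ ∈ energySpace} (hsol : IsSolution β c γ f φ hφ) :
    ∃ a : ℝ → ℂ, ((∀ᵐ ξ, a ξ = 0) → φ = 0) ∧ (Integrable fun ξ => |ξ| * ‖a ξ‖ ^ 2) ∧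
      (Integrable fun ξ => ‖a ξ‖ ^ 2) ∧ (Integrable fun ξ => (ξ ^ 2)⁻¹ * ‖a ξ‖ ^ 2) ∧
      (∫ x, φ x * f (φ x) = -(2 * Real.pi * β * ∫ ξ, |ξ| * ‖a ξ‖ ^ 2) + c * (∫ ξ, ‖a ξ‖ ^ 2) -
        γ / (2 * Real.pi) ^ 2 * ∫ ξ, (ξ ^ 2)⁻¹ * ‖a ξ‖ ^ 2) ∧
      (2 * ∫ x, φ x * f (φ x) = (p + 1) * (c * (∫ ξ, ‖a ξ‖ ^ 2) -
        3 * (γ / (2 * Real.pi) ^ 2) * ∫ ξ, (ξ ^ 2)⁻¹ * ‖a ξ‖ ^ 2)) := by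
  have hp0 : 0 < p := by linarith
  have hf0 : f 0 = 0 := by
    have := hom 0
    rw [zero_mul, eq_comm, mul_eq_zero] at this
    exact this.resolve_left hp0.ne'
  have hdf := hf.differentiable one_ne_zero
  obtain ⟨C, -, hC⟩ := homogeneous_abs_le hp0 hdf hom
  have hφq : MemLp φ (ENNReal.ofReal (2 * p)) volume := by
    -- The exponent `2p` exceeds 2 because `p > 1`.
    refine (memLp_of_half_sobolev (MemSobolev_half_memLp hφ.1) (q := 2 * p)
      (by linarith)).of_le (Lp.aestronglyMeasurable φ) ?_
    filter_upwards [coe_toComplex φ] with x hx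
    rw [hx, Complex.norm_real]
  have hgm := memLp_two_of_abs_le_rpow hp0 hf.continuous hC hφq
  set g : L2R := hgm.toLp _
  have hg : g =ᵐ[volume] fun x => f (φ x) := hgm.coeFn_toLp
  -- Euler's relation makes `s f(s)/(p+1)` a primitive of `f`; this is the source of the factor `p +
  -- 1` in the Pohozaev identity.
  have hF : ∀ s, HasDerivAt (fun s => (p + 1)⁻¹ * (s * f s)) (f s) s := fun s => by
    have h1 := (((hasDerivAt_id s).mul (hdf s).hasDerivAt).const_mul (p + 1)⁻¹)
    refine h1.congr_deriv ?_
    simp only [id_eq, one_mul]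
    rw [hom s]
    field_simp
    ring
  set a : Lp ℂ 2 (volume : Measure ℝ) := 𝓕 (toComplex φ) with ha
  have h0 : ∀ᵐ ξ : ℝ, ξ ≠ 0 := by
    rw [ae_iff]; simp
  have hβ' : 2 * Real.pi * β ≠ 0 := mul_ne_zero Real.two_pi_pos.ne' hβ
  have hγ' : γ / (2 * Real.pi) ^ 2 ≠ 0 := div_ne_zero hγ (pow_ne_zero _ Real.two_pi_pos.ne')
  have hb : (𝓕 (toComplex g) : Lp ℂ 2 (volume : Measure ℝ)) =ᵐ[volume] fun ξ : ℝ =>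
      ((-(2 * Real.pi * β * |ξ| - c + γ / (2 * Real.pi) ^ 2 * (ξ ^ 2)⁻¹) : ℝ) : ℂ) * a ξ := by
    filter_upwards [hsol.fourier_equation hg, h0] with ξ h1 hξ
    have hpi := Real.pi_ne_zero
    have hne : (2 * Real.pi * ξ) ^ 2 ≠ 0 := by positivity
    refine mul_left_cancel₀ (Complex.ofReal_ne_zero.2 hne) ?_
    rw [← mul_assoc, ← Complex.ofReal_mul]
    have e : (2 * Real.pi * ξ) ^ 2 *
        -(2 * Real.pi * β * |ξ| - c + γ / (2 * Real.pi) ^ 2 * (ξ ^ 2)⁻¹) =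
        (2 * Real.pi * ξ) ^ 2 * (c - 2 * Real.pi * β * |ξ|) - γ := by
      generalize |ξ| = s
      field_simp
      ring
    rw [e]
    exact (sub_eq_zero.1 h1).symm
  obtain ⟨hv, hw⟩ := memLp_mul_and_memLp_div_of_equation hβ' hγ' hb
  have hum : MemLp (fun ξ : ℝ => ((ξ⁻¹ : ℝ) : ℂ) * a ξ) 2 volume := by
    refine (hφ.2.const_mul (2 * Real.pi * Complex.I)).ae_eq (Eventually.of_forall fun ξ => ?_)
    have hpi : (Real.pi : ℂ) ≠ 0 := Complex.ofReal_ne_zero.2 Real.pi_ne_zero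
    simp only [invDerivFourier]
    rw [mul_inv, ← mul_assoc, ← mul_assoc, mul_inv_cancel₀ (by simp [hpi]), one_mul,
      Complex.ofReal_inv]
  set u := hum.toLp _
  have hu : u =ᵐ[volume] fun ξ : ℝ => ((ξ⁻¹ : ℝ) : ℂ) * a ξ := hum.coeFn_toLp
  have hP := pohozaev_identity hf hf0 hF hg hβ' hγ' hb hu
  have hE := energy_identity hb
  have hN : ∫ x, φ x * g x = ∫ x, φ x * f (φ x) := by
    refine integral_congr_ae ?_
    filter_upwards [hg] with x hx
    rw [hx]
  have i2 : Integrable fun ξ => ‖a ξ‖ ^ 2 := integrable_norm_sq_Lp a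
  have hu2 : (fun ξ => ‖u ξ‖ ^ 2) =ᵐ[volume] fun ξ => (ξ ^ 2)⁻¹ * ‖a ξ‖ ^ 2 := by
    filter_upwards [hu] with ξ h
    rw [h, norm_mul, Complex.norm_real, mul_pow, Real.norm_eq_abs, sq_abs, inv_pow]
  have i3 : Integrable fun ξ => (ξ ^ 2)⁻¹ * ‖a ξ‖ ^ 2 := (integrable_norm_sq_Lp u).congr hu2
  have i1 : Integrable fun ξ => |ξ| * ‖a ξ‖ ^ 2 := by
    have hva := hv.norm.integrable_mul (Lp.memLp a).norm
    refine hva.congr (Eventually.of_forall fun ξ => ?_)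
    simp only [Pi.mul_apply]
    rw [norm_mul, Complex.norm_real, Real.norm_eq_abs]
    ring
  refine ⟨a, fun h => eq_zero_of_fourier_ae_eq_zero h, i1, i2, i3, ?_, ?_⟩
  · rw [← hN, hE, ← integral_const_mul, ← integral_const_mul, ← integral_const_mul,
      ← integral_neg, ← integral_neg]
    have j1 : Integrable fun ξ => -(2 * Real.pi * β * (|ξ| * ‖a ξ‖ ^ 2)) := (i1.const_mul _).neg
    have j12 : Integrable fun ξ => -(2 * Real.pi * β * (|ξ| * ‖a ξ‖ ^ 2)) + c * ‖a ξ‖ ^ 2 :=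
      j1.add (i2.const_mul c)
    rw [← integral_add j1 (i2.const_mul c), ← integral_sub j12 (i3.const_mul _)]
    congr 1
    ext ξ
    ring
  · rw [hN, ← integral_norm_sq_eq, ← integral_norm_sq_eq, integral_congr_ae hu2] at hP
    have hp1 : p + 1 ≠ 0 := by linarith
    rw [← hP]
    field_simp

/-- Combining the two identities when the dispersion coefficients have opposite signs. -/
theorem eq_zero_of_cube_lt {p β c γ : ℝ} (hp : 1 < p) (hβ : β ≠ 0) (hγ : γ ≠ 0) {σ : ℝ}
    (hσβ : 0 < -σ * β) (hσγ : 0 < σ * γ) (hσ : σ ^ 2 = 1)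
    (hc : σ * c ^ 3 < σ * (27 * (3 * p + 1) * γ * β ^ 2 / (p - 1) ^ 3)) {f : ℝ → ℝ}
    (hf : ContDiff ℝ 1 f) (hom : ∀ s : ℝ, s * deriv f s = p * f s) {φ : L2R}
    {hφ : φ ∈ energySpace} (hsol : IsSolution β c γ f φ hφ) : φ = 0 := by
  obtain ⟨a, ha, i1, i2, i3, hE, hP⟩ := hsol.identities hp hf hom hβ hγ
  have hpi := Real.pi_pos
  -- Coefficients of `|ξ|` and `ξ⁻²` and the constant in the weight left after eliminating `∫ φ
  -- f(φ)`. The sign `σ = ±1` treats both sign patterns at once. The powers of `2π` cancel in `A²B`,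
  -- so `k³ < 27A²B/4` is the assumed bound on `c³` multiplied by `(p-1)³/8`.
  set A := 2 * Real.pi * (-σ * β)
  set B := (3 * p + 1) / 2 * (σ * γ) / (2 * Real.pi) ^ 2
  set k := σ * c * (p - 1) / 2
  have hA : 0 < A := by positivity
  have hB : 0 < B := by positivity
  have hk : k ^ 3 < 27 * (A ^ 2 * B) / 4 := by
    have h1 : k ^ 3 = σ * c ^ 3 * ((p - 1) ^ 3 / 8) := by
      simp only [k]
      linear_combination c ^ 3 * σ * (p - 1) ^ 3 / 8 * hσ
    have h2 : 27 * (A ^ 2 * B) / 4 =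
        σ * (27 * (3 * p + 1) * γ * β ^ 2 / (p - 1) ^ 3) * ((p - 1) ^ 3 / 8) := by
      have h3 : A ^ 2 * B = β ^ 2 * ((3 * p + 1) / 2 * (σ * γ)) := by
        simp only [A, B]
        field_simp
        linear_combination σ * hσ
      have h4 : p - 1 ≠ 0 := by linarith
      rw [h3]
      field_simp
      ring
    rw [h1, h2]
    exact mul_lt_mul_of_pos_right hc (div_pos (pow_pos (by linarith) 3) (by norm_num))
  have hi : Integrable fun ξ => (A * |ξ| + B * (ξ ^ 2)⁻¹ - k) * ‖a ξ‖ ^ 2 := by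
    refine (((i1.const_mul A).add (i3.const_mul B)).sub (i2.const_mul k)).congr
      (Eventually.of_forall fun ξ => ?_)
    simp only [Pi.add_apply, Pi.sub_apply]
    ring
  refine ha (ae_eq_zero_of_integral_mul_norm_sq_eq_zero
    (m := fun ξ => A * |ξ| + B * (ξ ^ 2)⁻¹ - k) (fun ξ hξ => ?_) hi ?_)
  · have := lt_mul_add_div_sq hA hB (abs_pos.2 hξ) hk
    rw [sq_abs] at this
    exact sub_pos.2 this
  · have j12 : Integrable fun ξ => A * (|ξ| * ‖a ξ‖ ^ 2) + B * ((ξ ^ 2)⁻¹ * ‖a ξ‖ ^ 2) :=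
      (i1.const_mul A).add (i3.const_mul B)
    have e : ∫ ξ, (A * |ξ| + B * (ξ ^ 2)⁻¹ - k) * ‖a ξ‖ ^ 2 =
        A * (∫ ξ, |ξ| * ‖a ξ‖ ^ 2) + B * (∫ ξ, (ξ ^ 2)⁻¹ * ‖a ξ‖ ^ 2) - k * ∫ ξ, ‖a ξ‖ ^ 2 := by
      rw [← integral_const_mul, ← integral_const_mul, ← integral_const_mul,
        ← integral_add (i1.const_mul A) (i3.const_mul B), ← integral_sub j12 (i2.const_mul k)]
      congr 1
      ext ξ
      ring
    rw [e]
    simp only [A, B, k]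
    -- Half the Pohozaev identity minus the energy identity cancels the nonlinear integral.
    linear_combination σ / 2 * hP - σ * hE

/-- The case of a sign-definite nonlinearity. -/
theorem eq_zero_of_mul_nonneg {p β c γ : ℝ} (hp : 1 < p) (hβ : β ≠ 0) (hγ : γ ≠ 0) {σ : ℝ}
    (hσβ : 0 < σ * β) (hσγ : 0 < -σ * γ) {f : ℝ → ℝ} (hσf : ∀ s, 0 ≤ σ * (s * f s))
    (hf : ContDiff ℝ 1 f) (hom : ∀ s : ℝ, s * deriv f s = p * f s) {φ : L2R}
    {hφ : φ ∈ energySpace} (hsol : IsSolution β c γ f φ hφ) : φ = 0 := by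
  obtain ⟨a, ha, i1, i2, i3, hE, hP⟩ := hsol.identities hp hf hom hβ hγ
  have hpi := Real.pi_pos
  have hN : 0 ≤ σ * ∫ x, φ x * f (φ x) := by
    rw [← integral_const_mul]
    exact integral_nonneg fun x => hσf _
  have hA : 0 ≤ ∫ ξ, |ξ| * ‖a ξ‖ ^ 2 := integral_nonneg fun ξ => by positivity
  have hQ : 0 ≤ ∫ ξ, (ξ ^ 2)⁻¹ * ‖a ξ‖ ^ 2 := integral_nonneg fun ξ => by positivity
  refine ha (ae_eq_zero_of_integral_mul_norm_sq_eq_zero (m := fun ξ => (ξ ^ 2)⁻¹)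
    (fun ξ hξ => by positivity) i3 ?_)
  -- Here the combination cancels the `c` term instead, so no restriction on the speed is needed.
  -- All three summands are nonnegative.
  have hsum : (p + 1) * (2 * Real.pi) * (σ * β) * (∫ ξ, |ξ| * ‖a ξ‖ ^ 2) +
      (p - 1) * (σ * ∫ x, φ x * f (φ x)) +
      2 * (p + 1) * ((-σ * γ) / (2 * Real.pi) ^ 2) * (∫ ξ, (ξ ^ 2)⁻¹ * ‖a ξ‖ ^ 2) = 0 := by
    linear_combination (p + 1) * σ * hE - σ * hP
  have hc : 0 < 2 * (p + 1) * ((-σ * γ) / (2 * Real.pi) ^ 2) := by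
    have : 0 < p + 1 := by linarith
    positivity
  have h1 : 0 ≤ (p + 1) * (2 * Real.pi) * (σ * β) * (∫ ξ, |ξ| * ‖a ξ‖ ^ 2) := by
    have : 0 < p + 1 := by linarith
    positivity
  have h2 : 0 ≤ (p - 1) * (σ * ∫ x, φ x * f (φ x)) := mul_nonneg (by linarith) hN
  refine le_antisymm ?_ hQ
  by_contra! h
  have := mul_pos hc h
  linarith

end RGBO

end

theorem theorem3p1 (p : ℝ) (hp : 1 < p) (β c γ : ℝ) (f : ℝ → ℝ)
    (hf : ContDiff ℝ 1 f) (hom : ∀ s : ℝ, s * deriv f s = p * f s)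
    (h : (β < 0 ∧ 0 < γ ∧ c ^ 3 < 27 * (3 * p + 1) * γ * β ^ 2 / (p - 1) ^ 3) ∨
      (0 < β ∧ γ < 0 ∧ 27 * (3 * p + 1) * γ * β ^ 2 / (p - 1) ^ 3 < c ^ 3) ∨
      ((f = fun u : ℝ => |u| ^ (p - 1) * u) ∧ 0 < β ∧ γ < 0) ∨
      ((f = fun u : ℝ => -(|u| ^ (p - 1) * u)) ∧ β < 0 ∧ 0 < γ)) :
    ¬ ∃ (φ : RGBO.L2R) (hφ : φ ∈ RGBO.energySpace),
      φ ≠ 0 ∧ RGBO.IsSolution β c γ f φ hφ := by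
  rintro ⟨φ, hφ, hne, hsol⟩
  refine hne ?_
  rcases h with ⟨hβ, hγ, hc⟩ | ⟨hβ, hγ, hc⟩ | ⟨hfe, hβ, hγ⟩ | ⟨hfe, hβ, hγ⟩
  · exact RGBO.eq_zero_of_cube_lt hp hβ.ne hγ.ne' (σ := 1) (by linarith) (by linarith)
      (by norm_num) (by linarith) hf hom hsol
  · exact RGBO.eq_zero_of_cube_lt hp hβ.ne' hγ.ne (σ := -1) (by linarith) (by linarith)
      (by norm_num) (by linarith) hf hom hsol
  · refine RGBO.eq_zero_of_mul_nonneg hp hβ.ne' hγ.ne (σ := 1) (by linarith) (by linarith)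
      (fun s => ?_) hf hom hsol
    -- With `f(s) = |s|^{p-1}s`, the product `s f(s)` is `|s|^{p-1}s²`, which is nonnegative.
    have : 0 ≤ |s| ^ (p - 1) * (s * s) := by have := mul_self_nonneg s; positivity
    rw [hfe]
    linarith
  · refine RGBO.eq_zero_of_mul_nonneg hp hβ.ne hγ.ne' (σ := -1) (by linarith) (by linarith)
      (fun s => ?_) hf hom hsol
    have : 0 ≤ |s| ^ (p - 1) * (s * s) := by have := mul_self_nonneg s; positivity
    rw [hfe]
    linarith
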